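/- **Theorem 4.1.** Let $H$ be a real Hilbert space, $C\subset H$ nonempty, closed and convex, and let $B:H\to H$ be $\beta$-cocoercive for some $\beta>0$, i.e. $\langle x-y,Bx-By\rangle\ge\beta\|Bx-By\|^2$ for all $x,y\in H$. Let $$\Omega=\{x^*\in C:\ \langle Bx^*,y-x^*\rangle\ge 0\ \text{ for all } y\in C\}$$ be the solution set of the variational inequality and assume $\Omega\ne\emptyset$. For self-adjoint bounded operators write $U\succeq V$ if $\langle Ux,x\rangle\ge\langle Vx,x\rangle$ for all $x\in H$. Let $\alpha>0$, let $(\eta_k)_{k\ge0}$ be a summable sequence in $[0,\infty)$, and let $(U_k)_{k\ge0}$ be bounded self-adjoint operators on $H$ with $U_k\succeq\alpha I$, $$\mu=\sup_k\|U_k\|<\infty,\qquad (1+\eta_k)U_{k+1}\succeq U_k\quad\text{for all }k.$$ Let $\gamma_k>0$ with $\gamma_k\|U_k\|<2\beta$, put $\alpha_k=\frac{2\beta}{4\beta-\gamma_k\|U_k\|}$, let $0<\lambda_k<\frac1{\alpha_k}$, and let $a_k,b_k\in H$ satisfy $\sum_k\lambda_k\|a_k\|<\infty$ and $\sum_k\lambda_k\|b_k\|<\infty$.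 For $W=U_k^{-1}$ write $\|x\|_W=\sqrt{\langle Wx,x\rangle}$ and let $P_C^W(x)$ be the unique minimizer of $y\mapsto\|x-y\|_W$ over $y\in C$. Let $x_0\in H$ and $$y_k=x_k-\gamma_kU_k(Bx_k+b_k),\qquad x_{k+1}=x_k+\lambda_k\big(P_C^{U_k^{-1}}(y_k)+a_k-x_k\big),\qquad k\ge0.$$ Consider the assertions - (i) for every $x^*\in\Omega$, $\lim_{k\to\infty}\|x_k-x^*\|_{U_k^{-1}}$ exists; - (ii) $\lim_{k\to\infty}\|x_k-P_C^{U_k^{-1}}(x_k-\gamma_kU_kBx_k)\|=0$; - (iii) $(x_k)$ converges weakly to a point of $\Omega$; - (iv) $Bx_k\to Bx^*$ strongly for every $x^*\in\Omega$. Then (i) holds, and moreover: **(A)** If there are constants $\underline\lambda>0$ and $\tau>0$ with $\underline\lambda\le\lambda_k\le\frac1{\alpha_k}-\tau$ for all $k$, then (ii) holds. If in addition $\gamma_k\ge\underline\gamma$ for all $k$ and some constant $\underline\gamma>0$, then (iii) holds. If further there is $\varepsilon>0$ with $\gamma_k\mu\le2\beta-\varepsilon$ for all $k$, then (iv) holds.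 **(B)** Suppose that - (a) $\sum_k\lambda_k\big(\frac1{\alpha_k}-\lambda_k\big)=+\infty$; - (b) there are $\underline\gamma>0$ and $\varepsilon>0$ with $\underline\gamma\le\gamma_k$ and $\gamma_k\mu\le2\beta-\varepsilon$ for all $k$; - (c) $\sum_k|\gamma_{k+1}-\gamma_k|<\infty$, $\sum_k\big|\gamma_{k+1}\|U_{k+1}\|-\gamma_k\|U_k\|\big|<\infty$, and $\sum_k\|U_k^{-1}x-U_{k+1}^{-1}x\|<\infty$ for every $x\in H$. Then (ii) and (iii) hold. If in addition $\lambda_k\ge\underline\lambda$ for all $k$ and some constant $\underline\lambda>0$, then (iv) holds. -/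

import Mathlib

open Filter Topology

namespace VMFB

variable {H : Type*} [NormedAddCommGroup H] [InnerProductSpace ℝ H]

/-- `B` is `β`-cocoercive: `⟪x - y, B x - B y⟫ ≥ β ‖B x - B y‖²` for all `x, y`. -/
def IsCocoercive (β : ℝ) (B : H → H) : Prop :=
  ∀ x y : H, β * ‖B x - B y‖ ^ 2 ≤ inner ℝ (x - y) (B x - B y)

/-- The solution set of the variational inequality: all `x ∈ C` such that
`⟪B x, y - x⟫ ≥ 0` for every `y ∈ C`. -/
def vipSolutions (C : Set H) (B : H → H) : Set H :=
  {x | x ∈ C ∧ ∀ y ∈ C, 0 ≤ inner ℝ (B x) (y - x)}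

/-- The class of bounded self-adjoint operators `U` with `U ≽ α I` (Loewner order). -/
def strongPos [CompleteSpace H] (α : ℝ) : Set (H →L[ℝ] H) :=
  {U | IsSelfAdjoint U ∧ α • ContinuousLinearMap.id ℝ H ≤ U}

/-- The weighted norm `‖x‖_W = √⟪W x, x⟫`. -/
noncomputable def wnorm (W : H →L[ℝ] H) (x : H) : ℝ :=
  √(inner ℝ (W x) x)

/-- `p` is a point of `C` nearest to `x` in the norm `‖·‖_W`. -/
def IsNearest (W : H →L[ℝ] H) (C : Set H) (x p : H) : Prop :=
  p ∈ C ∧ ∀ y ∈ C, wnorm W (x - p) ≤ wnorm W (x - y)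

/-- The projector `P_C^W` onto `C` relative to the norm `‖·‖_W`, i.e. the nearest point of `C`.
This point exists and is unique if `C` is nonempty, closed and convex and `W` is self-adjoint and
bounded below by a positive multiple of the identity. -/
noncomputable def wproj (W : H →L[ℝ] H) (C : Set H) (x : H) : H :=
  Classical.epsilon (IsNearest W C x)

/-- Weak convergence of a sequence in `H`. -/
def WeaklyConverges (x : ℕ → H) (z : H) : Prop :=
  Tendsto (fun k => toWeakSpace ℝ H (x k)) atTop (𝓝 (toWeakSpace ℝ H z))

/-- The averagedness constant `2β / (4β - γ ‖U‖)` of a forward-backward step with step size `γ`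
and metric operator `U`. -/
noncomputable def avgConst (β γ : ℝ) (U : H →L[ℝ] H) : ℝ :=
  2 * β / (4 * β - γ * ‖U‖)

end VMFB

namespace VMFB

variable {H : Type*} [NormedAddCommGroup H] [InnerProductSpace ℝ H]

/-! ### Real sequences -/

/-! Write `W k` for the inverse of `U k`, `r k` for the residual of the exact forward-backward step,
`z` for a solution, and δ = γ‖U‖/(2β), so that 1/α_k = 2 - δ. Combining the variational inequalities
of the projection and of `z` with cocoercivity gives ⟪W r, x - z⟫ = (1 - δ/2)‖r‖² + S in the
`W`-norm, where S ≥ 0 is the total slack of the inequalities used. Hence the exact relaxed step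
lowers ‖x - z‖² by precisely λ(1/α_k - λ)‖r‖² + 2λS.

The errors are summable in the weighted norms and the metrics grow by factors at most 1 + η_k, so
the weighted distances converge, which is (i), and both parts of the decrease are summable
(`quasiFejer`).

In case (A) the first part already forces r → 0. In case (B) the factor 1/α_k - λ may vanish and the
slack does the work: `exists_slack` bounds a multiple of ‖r‖² by S + √(2S)‖x - z - r‖, so that, with
δ kept away from 0 and 1, ∑ λ‖r‖⁴ < ∞, while ∑ λ = ∞. To turn this into convergence, `r k` is
replaced by the residual of one fixed forward-backward map, which is comparable to it uniformly in
`k` (`residual_equiv`) and Lipschitz. That residual changes in one step by at most a multiple of λ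
times itself, plus a summable error, and `tendsto_zero_of_summable_mul_pow` concludes.

Once r → 0, weak cluster points are solutions by Minty's lemma. The metrics converge strongly, so
Opial's argument makes the cluster point unique. Strong convergence of B x_k follows from a second
one-step estimate, `mul_norm_sub_sq_le`, whose right-hand side is at most a multiple of ‖r‖ along
the bounded iterates. -/

theorem exists_tendsto_of_le_add {u c : ℕ → ℝ} (hu : ∀ k, 0 ≤ u k) (hc : Summable c)
    (h : ∀ k, u (k + 1) ≤ u k + c k) : ∃ l : ℝ, Tendsto u atTop (𝓝 l) := by
  have hs := hc.hasSum.tendsto_sum_nat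
  have hanti : Antitone fun k => u k - ∑ j ∈ Finset.range k, c j :=
    antitone_nat_of_succ_le fun k => by
      rw [Finset.sum_range_succ]; linarith [h k]
  have hbdd : BddBelow (Set.range fun k => u k - ∑ j ∈ Finset.range k, c j) := by
    obtain ⟨M, hM⟩ := hs.bddAbove_range
    refine ⟨-M, ?_⟩
    rintro _ ⟨k, rfl⟩
    have := hM ⟨k, rfl⟩
    linarith [hu k]
  have := (tendsto_atTop_ciInf hanti hbdd).add hs
  exact ⟨_, by simpa using this⟩

theorem prod_one_add_bounds {η : ℕ → ℝ} (hη : ∀ k, 0 ≤ η k) (hs : Summable η) (k : ℕ) :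
    1 ≤ ∏ j ∈ Finset.range k, (1 + η j) ∧
      ∏ j ∈ Finset.range k, (1 + η j) ≤ Real.exp (∑' j, η j) := by
  constructor
  · exact Finset.prod_induction _ (fun x => 1 ≤ x) (fun _ _ => one_le_mul_of_one_le_of_one_le)
      le_rfl fun j _ => by linarith [hη j]
  · calc _ ≤ ∏ j ∈ Finset.range k, Real.exp (η j) :=
          Finset.prod_le_prod (fun j _ => by linarith [hη j])
            fun j _ => by linarith [Real.add_one_le_exp (η j)]
      _ = Real.exp (∑ j ∈ Finset.range k, η j) := (Real.exp_sum _ _).symm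
      _ ≤ _ := Real.exp_le_exp.2 (hs.sum_le_tsum _ fun j _ => hη j)

/-- A nonnegative sequence that is nonincreasing up to summable multiplicative and additive
perturbations converges. -/
theorem exists_tendsto_of_le_mul_add {u η c : ℕ → ℝ} (hu : ∀ k, 0 ≤ u k) (hη : ∀ k, 0 ≤ η k)
    (hηs : Summable η) (hc : ∀ k, 0 ≤ c k) (hcs : Summable c)
    (h : ∀ k, u (k + 1) ≤ (1 + η k) * (u k + c k)) : ∃ l : ℝ, Tendsto u atTop (𝓝 l) := by
  have hbd : ∀ k, u k ≤ (∏ j ∈ Finset.range k, (1 + η j)) *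
      (u 0 + ∑ j ∈ Finset.range k, c j) := by
    intro k
    induction k with
    | zero => simp
    | succ k ih =>
      have h1 := (prod_one_add_bounds hη hηs k).1
      rw [Finset.prod_range_succ, Finset.sum_range_succ]
      calc u (k + 1) ≤ (1 + η k) * (u k + c k) := h k
        _ ≤ (1 + η k) * ((∏ j ∈ Finset.range k, (1 + η j)) *
            (u 0 + ∑ j ∈ Finset.range k, c j) + (∏ j ∈ Finset.range k, (1 + η j)) * c k) := by
          have : c k ≤ (∏ j ∈ Finset.range k, (1 + η j)) * c k :=
            le_mul_of_one_le_left (hc k) h1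
          have := hη k
          gcongr
        _ = _ := by ring
  set M := Real.exp (∑' j, η j) * (u 0 + ∑' j, c j) with hM
  have huM : ∀ k, u k ≤ M := fun k => (hbd k).trans <| by
    have h1 := prod_one_add_bounds hη hηs k
    have h2 : ∑ j ∈ Finset.range k, c j ≤ ∑' j, c j := hcs.sum_le_tsum _ fun j _ => hc j
    have h3 : 0 ≤ ∑ j ∈ Finset.range k, c j := Finset.sum_nonneg fun j _ => hc j
    exact mul_le_mul h1.2 (by linarith) (by linarith [hu 0]) (Real.exp_pos _).le
  have hcb : ∀ k, c k ≤ ∑' j, c j := fun k => hcs.le_tsum k fun j _ => hc j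
  refine exists_tendsto_of_le_add hu (c := fun k => η k * (M + ∑' j, c j) + c k)
    ((hηs.mul_right _).add hcs) fun k => ?_
  have : η k * (u k + c k) ≤ η k * (M + ∑' j, c j) :=
    mul_le_mul_of_nonneg_left (add_le_add (huM k) (hcb k)) (hη k)
  linarith [h k]

theorem summable_of_le_sub_add {V D c : ℕ → ℝ} (hV : ∀ k, 0 ≤ V k) (hD : ∀ k, 0 ≤ D k)
    (hcs : Summable c) (h : ∀ k, V (k + 1) ≤ V k - D k + c k) : Summable D := by
  obtain ⟨M, hM⟩ := hcs.hasSum.tendsto_sum_nat.bddAbove_range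
  refine summable_of_sum_range_le (c := V 0 + M) hD fun n => ?_
  have : V n + ∑ k ∈ Finset.range n, D k ≤ V 0 + ∑ k ∈ Finset.range n, c k := by
    induction n with
    | zero => simp
    | succ n ih => rw [Finset.sum_range_succ, Finset.sum_range_succ]; linarith [h n]
  linarith [hV n, hM ⟨n, rfl⟩]

/-! ### Weighted norms -/

theorem inner_sq_le_of_nonneg {W : H →L[ℝ] H} (hs : ∀ x y, inner ℝ (W x) y = inner ℝ x (W y))
    (hp : ∀ x, 0 ≤ inner ℝ (W x) x) (x y : H) :
    inner ℝ (W x) y ^ 2 ≤ inner ℝ (W x) x * inner ℝ (W y) y := by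
  have h : ∀ t : ℝ, 0 ≤ inner ℝ (W y) y * (t * t) + (2 * inner ℝ (W x) y) * t
      + inner ℝ (W x) x := by
    intro t
    have := hp (x + t • y)
    simp only [map_add, map_smul, inner_add_left, inner_add_right, real_inner_smul_left,
      real_inner_smul_right] at this
    rw [hs y x, real_inner_comm (W x) y] at this
    linarith
  have := discrim_le_zero h
  rw [discrim] at this
  nlinarith

/-- Cauchy-Schwarz for the form of `W`, taken at `x` and `W x`, followed by cancellation of ‖W x‖².
It upgrades convergence of quadratic forms to strong convergence of operators. -/
theorem norm_sq_apply_le_of_nonneg {W : H →L[ℝ] H}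
    (hs : ∀ x y, inner ℝ (W x) y = inner ℝ x (W y)) (hp : ∀ x, 0 ≤ inner ℝ (W x) x) {K : ℝ}
    (hK : ∀ x, inner ℝ (W x) x ≤ K * ‖x‖ ^ 2) (x : H) :
    ‖W x‖ ^ 2 ≤ K * inner ℝ (W x) x := by
  have h := inner_sq_le_of_nonneg hs hp x (W x)
  rw [real_inner_self_eq_norm_sq] at h
  rcases eq_or_ne (W x) 0 with h0 | h0
  · simp [h0]
  · have h2 : 0 < ‖W x‖ ^ 2 := by positivity
    have h3 := mul_le_mul_of_nonneg_left (hK (W x)) (hp x)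
    nlinarith

/-- `W` is symmetric, bounded below by `c` and bounded above by `d`. -/
structure IsMetric (c d : ℝ) (W : H →L[ℝ] H) : Prop where
  pos : 0 < c
  symm : ∀ x y, inner ℝ (W x) y = inner ℝ x (W y)
  lower : ∀ x, c * ‖x‖ ^ 2 ≤ inner ℝ (W x) x
  upper : ∀ x, ‖W x‖ ≤ d * ‖x‖

namespace IsMetric
variable {c d : ℝ} {W : H →L[ℝ] H}

theorem nonneg (hW : IsMetric c d W) (x : H) : 0 ≤ inner ℝ (W x) x :=
  (mul_nonneg hW.pos.le (sq_nonneg _)).trans (hW.lower x)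

theorem wnorm_sq (hW : IsMetric c d W) (x : H) : wnorm W x ^ 2 = inner ℝ (W x) x :=
  Real.sq_sqrt (hW.nonneg x)

theorem inner_comm (hW : IsMetric c d W) (x y : H) : inner ℝ (W x) y = inner ℝ (W y) x := by
  rw [hW.symm, real_inner_comm]

theorem abs_inner_le (hW : IsMetric c d W) (x y : H) :
    |inner ℝ (W x) y| ≤ wnorm W x * wnorm W y := by
  refine abs_le_of_sq_le_sq ?_ (mul_nonneg (Real.sqrt_nonneg _) (Real.sqrt_nonneg _))
  rw [mul_pow, hW.wnorm_sq, hW.wnorm_sq]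
  exact inner_sq_le_of_nonneg hW.symm hW.nonneg x y

theorem inner_add_self (hW : IsMetric c d W) (x y : H) :
    inner ℝ (W (x + y)) (x + y) =
      inner ℝ (W x) x + 2 * inner ℝ (W x) y + inner ℝ (W y) y := by
  rw [map_add, inner_add_left, inner_add_right, inner_add_right, hW.inner_comm y x]; ring

theorem inner_sub_self (hW : IsMetric c d W) (x y : H) :
    inner ℝ (W (x - y)) (x - y) =
      inner ℝ (W x) x - 2 * inner ℝ (W x) y + inner ℝ (W y) y := by
  rw [map_sub, inner_sub_left, inner_sub_right, inner_sub_right, hW.inner_comm y x]; ring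

theorem wnorm_add_le (hW : IsMetric c d W) (x y : H) :
    wnorm W (x + y) ≤ wnorm W x + wnorm W y := by
  have h0 : 0 ≤ wnorm W x := Real.sqrt_nonneg _
  have h1 : 0 ≤ wnorm W y := Real.sqrt_nonneg _
  refine le_of_sq_le_sq ?_ (add_nonneg h0 h1)
  rw [hW.wnorm_sq, hW.inner_add_self, ← hW.wnorm_sq, ← hW.wnorm_sq]
  nlinarith [(abs_le.1 (hW.abs_inner_le x y)).2]

theorem lower_wnorm (hW : IsMetric c d W) (x : H) : c * ‖x‖ ^ 2 ≤ wnorm W x ^ 2 :=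
  (hW.lower x).trans_eq (hW.wnorm_sq x).symm

theorem upper_inner (hW : IsMetric c d W) (x : H) : inner ℝ (W x) x ≤ d * ‖x‖ ^ 2 :=
  calc _ ≤ ‖W x‖ * ‖x‖ := real_inner_le_norm _ _
    _ ≤ d * ‖x‖ * ‖x‖ := mul_le_mul_of_nonneg_right (hW.upper x) (norm_nonneg _)
    _ = _ := by ring

theorem upper_wnorm (hW : IsMetric c d W) (x : H) : wnorm W x ^ 2 ≤ d * ‖x‖ ^ 2 :=
  (hW.wnorm_sq x).trans_le (hW.upper_inner x)

end IsMetric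

theorem wnorm_nonneg (W : H →L[ℝ] H) (x : H) : 0 ≤ wnorm W x := Real.sqrt_nonneg _

theorem wnorm_smul (W : H →L[ℝ] H) (t : ℝ) (x : H) : wnorm W (t • x) = |t| * wnorm W x := by
  rw [wnorm, wnorm, map_smul, real_inner_smul_left, real_inner_smul_right, ← mul_assoc,
    Real.sqrt_mul (mul_self_nonneg t), Real.sqrt_mul_self_eq_abs]

theorem isMetric_id : IsMetric 1 1 (ContinuousLinearMap.id ℝ H) :=
  ⟨one_pos, fun _ _ => rfl, fun x => by simp, fun x => by simp⟩

/-! ### Projections -/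

theorem exists_inner_sub_le_zero [CompleteSpace H] {C : Set H} (hne : C.Nonempty)
    (hcl : IsClosed C) (hcv : Convex ℝ C) (x : H) :
    ∃ p ∈ C, ∀ y ∈ C, inner ℝ (x - p) (y - p) ≤ 0 := by
  obtain ⟨p, hp, h⟩ := exists_norm_eq_iInf_of_complete_convex hne hcl.isComplete hcv x
  exact ⟨p, hp, (norm_eq_iInf_iff_real_inner_le_zero hcv hp).1 h⟩

namespace IsMetric
variable {c d : ℝ} {W : H →L[ℝ] H} [CompleteSpace H]

/-- Existence of the projection with respect to a metric, as a fixed point of the contraction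
`p ↦ P_C (p + t W (x - p))`. -/
theorem exists_inner_le_zero (hW : IsMetric c d W) {C : Set H} (hne : C.Nonempty)
    (hcl : IsClosed C) (hcv : Convex ℝ C) (x : H) :
    ∃ p ∈ C, ∀ y ∈ C, inner ℝ (W (x - p)) (y - p) ≤ 0 := by
  choose P hPC hP using exists_inner_sub_le_zero hne hcl hcv
  have hlip : ∀ u v, ‖P u - P v‖ ≤ ‖u - v‖ := by
    intro u v
    have h1 := hP u (P v) (hPC v)
    have h2 := hP v (P u) (hPC u)
    have h3 : ‖P u - P v‖ ^ 2 ≤ inner ℝ (u - v) (P u - P v) := by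
      have e1 : inner ℝ (u - v) (P u - P v) - ‖P u - P v‖ ^ 2 =
          - inner ℝ (u - P u) (P v - P u) - inner ℝ (v - P v) (P u - P v) := by
        rw [← real_inner_self_eq_norm_sq, ← inner_sub_left, ← neg_sub (P u) (P v),
          inner_neg_right, neg_neg, ← inner_sub_left]
        congr 1; abel
      linarith
    have h4 := h3.trans (real_inner_le_norm _ _)
    rcases eq_or_ne ‖P u - P v‖ 0 with h0 | h0
    · rw [h0]; positivity
    · have : 0 < ‖P u - P v‖ := lt_of_le_of_ne (norm_nonneg _) h0.symm
      nlinarith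
  -- `IsMetric` does not include c ≤ d, which fails to be automatic in the zero space; the maximum
  -- guarantees 0 < D and c²/D² ≤ 1.
  set D := max d c with hD
  have hc := hW.pos
  have hDc : c ≤ D := le_max_right _ _
  have hD0 : 0 < D := hc.trans_le hDc
  -- This step minimizes 1 - 2tc + t²D², the bound for the squared Lipschitz constant of v ↦ v - t W
  -- v.
  set t := c / D ^ 2 with ht
  have ht0 : 0 < t := by positivity
  have hcon : ∀ v, ‖v - t • W v‖ ^ 2 ≤ (1 - c ^ 2 / D ^ 2) * ‖v‖ ^ 2 := by
    intro v
    rw [norm_sub_sq_real, real_inner_smul_right, norm_smul, mul_pow, Real.norm_eq_abs, sq_abs]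
    have h1 := hW.lower v
    rw [hW.symm] at h1
    have h2 : ‖W v‖ ^ 2 ≤ D ^ 2 * ‖v‖ ^ 2 := by
      rw [← mul_pow]
      exact pow_le_pow_left₀ (norm_nonneg _) ((hW.upper v).trans
        (mul_le_mul_of_nonneg_right (le_max_left _ _) (norm_nonneg _))) 2
    have h3 := mul_le_mul_of_nonneg_left h1 ht0.le
    have h4 := mul_le_mul_of_nonneg_left h2 (sq_nonneg t)
    have e1 : t * (c * ‖v‖ ^ 2) = c ^ 2 / D ^ 2 * ‖v‖ ^ 2 := by rw [ht]; field_simp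
    have e2 : t ^ 2 * (D ^ 2 * ‖v‖ ^ 2) = c ^ 2 / D ^ 2 * ‖v‖ ^ 2 := by rw [ht]; field_simp
    linarith
  have hk0 : 0 ≤ 1 - c ^ 2 / D ^ 2 := by
    have : c ^ 2 / D ^ 2 ≤ 1 := by
      rw [div_le_one (by positivity)]; gcongr
    linarith
  set k := √(1 - c ^ 2 / D ^ 2) with hk
  have hk1 : k < 1 := by
    rw [hk, Real.sqrt_lt' one_pos]
    have : 0 < c ^ 2 / D ^ 2 := by positivity
    linarith
  have hf : ContractingWith (NNReal.mk k (Real.sqrt_nonneg _)) fun p => P (p + t • W (x - p)) := by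
    refine ⟨hk1, LipschitzWith.of_dist_le_mul fun p q => ?_⟩
    rw [dist_eq_norm, dist_eq_norm]
    refine (hlip _ _).trans ?_
    have e : p + t • W (x - p) - (q + t • W (x - q)) = (p - q) - t • W (p - q) := by
      simp only [map_sub, smul_sub]; abel
    rw [e]
    refine le_of_sq_le_sq ?_ (mul_nonneg (Real.sqrt_nonneg _) (norm_nonneg _))
    rw [mul_pow]
    exact (hcon _).trans_eq (by rw [NNReal.coe_mk, hk, Real.sq_sqrt hk0])
  have : Nonempty H := ⟨x⟩
  have hfix : P (hf.fixedPoint _ + t • W (x - hf.fixedPoint _)) = hf.fixedPoint _ :=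
    hf.fixedPoint_isFixedPt
  set p := hf.fixedPoint _ with hp
  refine ⟨p, hfix ▸ hPC _, fun y hy => ?_⟩
  have := hP (p + t • W (x - p)) y hy
  rw [hfix, add_sub_cancel_left, real_inner_smul_left] at this
  exact nonpos_of_mul_nonpos_right this ht0

/-- The point obtained from the contraction beats any other y ∈ C by at least c‖y - p‖² in squared
weighted distance. It is therefore the only nearest point, and the choice made in `wproj` must
return it. -/
theorem wproj_spec (hW : IsMetric c d W) {C : Set H} (hne : C.Nonempty)
    (hcl : IsClosed C) (hcv : Convex ℝ C) (x : H) :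
    wproj W C x ∈ C ∧ ∀ y ∈ C, inner ℝ (W (x - wproj W C x)) (y - wproj W C x) ≤ 0 := by
  obtain ⟨p, hp, h⟩ := hW.exists_inner_le_zero hne hcl hcv x
  have key : ∀ y ∈ C, wnorm W (x - p) ^ 2 + c * ‖y - p‖ ^ 2 ≤ wnorm W (x - y) ^ 2 := by
    intro y hy
    have e : x - y = (x - p) - (y - p) := by abel
    rw [hW.wnorm_sq, hW.wnorm_sq, e, hW.inner_sub_self (x - p)]
    linarith [h y hy, hW.lower (y - p)]
  have hnear : IsNearest W C x p := by
    refine ⟨hp, fun y hy => le_of_sq_le_sq ?_ (wnorm_nonneg _ _)⟩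
    have := mul_nonneg hW.pos.le (sq_nonneg ‖y - p‖)
    linarith [key y hy]
  have hs : IsNearest W C x (wproj W C x) := Classical.epsilon_spec ⟨p, hnear⟩
  have : wproj W C x = p := by
    have h1 := key _ hs.1
    have h2 := pow_le_pow_left₀ (wnorm_nonneg _ _) (hs.2 p hp) 2
    have h3 : c * ‖wproj W C x - p‖ ^ 2 ≤ 0 := by linarith
    have h4 : ‖wproj W C x - p‖ ^ 2 ≤ 0 := nonpos_of_mul_nonpos_right h3 hW.pos
    exact sub_eq_zero.1 (norm_eq_zero.1 (pow_eq_zero_iff two_ne_zero |>.1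
      (le_antisymm h4 (sq_nonneg _))))
  rw [this]; exact ⟨hp, h⟩

/-- Adding the two variational inequalities gives firm nonexpansiveness in the weighted inner
product; Cauchy-Schwarz finishes. -/
theorem wnorm_wproj_sub_le (hW : IsMetric c d W) {C : Set H} (hne : C.Nonempty)
    (hcl : IsClosed C) (hcv : Convex ℝ C) (u v : H) :
    wnorm W (wproj W C u - wproj W C v) ≤ wnorm W (u - v) := by
  obtain ⟨hu, h1⟩ := hW.wproj_spec hne hcl hcv u
  obtain ⟨hv, h2⟩ := hW.wproj_spec hne hcl hcv v
  have h1 := h1 _ hv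
  have h2 := h2 _ hu
  set p := wproj W C u
  set q := wproj W C v
  have h3 : wnorm W (p - q) ^ 2 ≤ inner ℝ (W (u - v)) (p - q) := by
    have e1 : inner ℝ (W (u - v)) (p - q) - wnorm W (p - q) ^ 2 =
        - inner ℝ (W (u - p)) (q - p) - inner ℝ (W (v - q)) (p - q) := by
      rw [hW.wnorm_sq, ← inner_sub_left, ← map_sub, ← neg_sub p q,
        inner_neg_right, neg_neg, ← inner_sub_left, ← map_sub]
      congr 2; abel
    linarith
  have h4 := h3.trans (abs_le.1 (hW.abs_inner_le _ _)).2
  rcases eq_or_ne (wnorm W (p - q)) 0 with h0 | h0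
  · rw [h0]; exact wnorm_nonneg _ _
  · have : 0 < wnorm W (p - q) := lt_of_le_of_ne (wnorm_nonneg _ _) h0.symm
    nlinarith

end IsMetric

/-! ### Inverses of metric operators -/

section Inverse
variable {α : ℝ} {U V : H →L[ℝ] H}

theorem inner_le_inner_of_le (h : U ≤ V) (x : H) : inner ℝ (U x) x ≤ inner ℝ (V x) x := by
  have := ((ContinuousLinearMap.le_def _ _).1 h).inner_nonneg_left x
  rw [sub_apply, inner_sub_left] at this
  linarith

variable [CompleteSpace H]

theorem mul_norm_sq_le_inner (hU : U ∈ strongPos α) (x : H) :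
    α * ‖x‖ ^ 2 ≤ inner ℝ (U x) x := by
  have := inner_le_inner_of_le hU.2 x
  simpa [real_inner_smul_left] using this

theorem inner_apply_symm (hU : U ∈ strongPos α) (x y : H) :
    inner ℝ (U x) y = inner ℝ x (U y) :=
  (ContinuousLinearMap.isSelfAdjoint_iff_isSymmetric.1 hU.1) x y

theorem exists_equiv (hα : 0 < α) (hU : U ∈ strongPos α) :
    ∃ e : H ≃L[ℝ] H, (e : H →L[ℝ] H) = U := by
  have : IsUnit U := by
    refine ContinuousLinearMap.isUnit_of_forall_le_norm_inner_map U
      (c := NNReal.mk α hα.le) hα fun x => ?_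
    have h := mul_norm_sq_le_inner hU x
    have h2 := le_abs_self (inner ℝ (U x) x)
    rw [← Real.norm_eq_abs] at h2
    refine le_trans ?_ (h.trans h2)
    rw [mul_comm]; rfl
  obtain ⟨u, rfl⟩ := this
  exact ⟨ContinuousLinearEquiv.unitsEquiv ℝ H u, rfl⟩

theorem inverse_apply_apply (hα : 0 < α) (hU : U ∈ strongPos α) (x : H) :
    U.inverse (U x) = x := by
  obtain ⟨e, rfl⟩ := exists_equiv hα hU
  simp [ContinuousLinearMap.inverse_equiv]

theorem apply_inverse_apply (hα : 0 < α) (hU : U ∈ strongPos α) (x : H) :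
    U (U.inverse x) = x := by
  obtain ⟨e, rfl⟩ := exists_equiv hα hU
  simp [ContinuousLinearMap.inverse_equiv]

theorem isMetric_inverse (hα : 0 < α) (hU : U ∈ strongPos α) {K : ℝ} (hK : 0 < K)
    (hUK : ‖U‖ ≤ K) : IsMetric (α / K ^ 2) (1 / α) U.inverse := by
  have hi := apply_inverse_apply hα hU
  refine ⟨by positivity, fun x y => ?_, fun x => ?_, fun x => ?_⟩
  · conv_lhs => rw [← hi y]
    conv_rhs => rw [← hi x]
    rw [inner_apply_symm hU]
  · have h1 := mul_norm_sq_le_inner hU (U.inverse x)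
    rw [hi, real_inner_comm] at h1
    refine le_trans ?_ h1
    have h2 : ‖x‖ ≤ K * ‖U.inverse x‖ := by
      calc ‖x‖ = ‖U (U.inverse x)‖ := by rw [hi]
        _ ≤ ‖U‖ * ‖U.inverse x‖ := U.le_opNorm _
        _ ≤ _ := by gcongr
    have h3 := pow_le_pow_left₀ (norm_nonneg _) h2 2
    rw [div_mul_eq_mul_div, div_le_iff₀ (by positivity)]
    nlinarith
  · have h1 := mul_norm_sq_le_inner hU (U.inverse x)
    rw [hi] at h1
    have h2 := h1.trans (real_inner_le_norm _ _)
    rw [one_div, inv_mul_eq_div, le_div_iff₀ hα]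
    rcases eq_or_ne ‖U.inverse x‖ 0 with h0 | h0
    · rw [h0]; simp
    · have : 0 < ‖U.inverse x‖ := lt_of_le_of_ne (norm_nonneg _) h0.symm
      nlinarith

/-- Inversion reverses the Loewner order. With u = U⁻¹x and v = V⁻¹x, expand 0 ≤ ⟪U(tu - v), tu - v⟫
and bound ⟪U v, v⟫ by t⟪V v, v⟫ = t⟪x, v⟫. -/
theorem inner_inverse_le (hα : 0 < α) (hU : U ∈ strongPos α) (hV : V ∈ strongPos α) {t : ℝ}
    (ht : 0 < t) (h : U ≤ t • V) (x : H) :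
    inner ℝ (V.inverse x) x ≤ t * inner ℝ (U.inverse x) x := by
  set u := U.inverse x with hu
  set v := V.inverse x with hv
  have hUu : U u = x := apply_inverse_apply hα hU x
  have hVv : V v = x := apply_inverse_apply hα hV x
  have h1 := (mul_nonneg hα.le (sq_nonneg _)).trans (mul_norm_sq_le_inner hU (t • u - v))
  have h2 := inner_le_inner_of_le h v
  rw [smul_apply, hVv, real_inner_smul_left] at h2
  simp only [map_sub, map_smul, hUu, inner_sub_left, inner_sub_right, real_inner_smul_left,
    real_inner_smul_right, inner_apply_symm hU v u] at h1
  rw [real_inner_comm x v] at h1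
  rw [real_inner_comm x u, real_inner_comm x v]
  have : 0 ≤ t * (t * inner ℝ x u - inner ℝ x v) := by nlinarith
  linarith [nonneg_of_mul_nonneg_right this ht]

end Inverse

/-! ### Cocoercive operators -/

theorem IsCocoercive.norm_sub_le {β : ℝ} (hβ : 0 < β) {B : H → H} (hB : IsCocoercive β B)
    (x y : H) : ‖B x - B y‖ ≤ 1 / β * ‖x - y‖ := by
  have h := (hB x y).trans (real_inner_le_norm _ _)
  rw [one_div, inv_mul_eq_div, le_div_iff₀ hβ]
  rcases eq_or_ne ‖B x - B y‖ 0 with h0 | h0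
  · rw [h0]; simp
  · have : 0 < ‖B x - B y‖ := lt_of_le_of_ne (norm_nonneg _) h0.symm
    nlinarith

theorem IsCocoercive.continuous {β : ℝ} (hβ : 0 < β) {B : H → H} (hB : IsCocoercive β B) :
    Continuous B := by
  refine LipschitzWith.continuous (K := (1 / β).toNNReal) (LipschitzWith.of_dist_le_mul ?_)
  intro x y
  rw [dist_eq_norm, dist_eq_norm, Real.coe_toNNReal _ (by positivity)]
  exact hB.norm_sub_le hβ x y

/-! ### The forward-backward step -/

section Step
variable {c d β γ : ℝ} {W U : H →L[ℝ] H} {C : Set H} {B : H → H}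

theorem inner_apply_self_le (hWU : ∀ v, W (U v) = v) (v : H) :
    inner ℝ (W (U v)) (U v) ≤ ‖U‖ * ‖v‖ ^ 2 := by
  rw [hWU]
  calc _ ≤ ‖v‖ * ‖U v‖ := real_inner_le_norm _ _
    _ ≤ ‖v‖ * (‖U‖ * ‖v‖) := by gcongr; exact U.le_opNorm _
    _ = _ := by ring

variable [CompleteSpace H]

theorem forwardBackward_inner_nonneg (hW : IsMetric c d W) (hWU : ∀ v, W (U v) = v)
    (hne : C.Nonempty) (hcl : IsClosed C) (hcv : Convex ℝ C) (x : H) {y : H} (hy : y ∈ C) :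
    inner ℝ (W (x - wproj W C (x - γ • U (B x)))) (y - wproj W C (x - γ • U (B x))) ≤
      γ * inner ℝ (B x) (y - wproj W C (x - γ • U (B x))) := by
  have h := (hW.wproj_spec hne hcl hcv (x - γ • U (B x))).2 y hy
  set T := wproj W C (x - γ • U (B x))
  have e : W (x - γ • U (B x) - T) = W (x - T) - γ • B x := by
    rw [sub_right_comm, map_sub, map_smul, hWU]
  rw [e, inner_sub_left, real_inner_smul_left] at h
  linarith

theorem slack_nonneg (hW : IsMetric c d W) (hWU : ∀ v, W (U v) = v)
    (hcl : IsClosed C) (hcv : Convex ℝ C) (hγ : 0 < γ) (x : H) {z : H}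
    (hz : z ∈ vipSolutions C B) :
    0 ≤ inner ℝ (W (x - wproj W C (x - γ • U (B x))))
        (x - z - (x - wproj W C (x - γ • U (B x)))) -
      γ * inner ℝ (B x - B z) (x - z - (x - wproj W C (x - γ • U (B x)))) := by
  have hne : C.Nonempty := ⟨z, hz.1⟩
  have h1 := forwardBackward_inner_nonneg (B := B) (γ := γ) hW hWU hne hcl hcv x hz.1
  have h2 := hz.2 _ (hW.wproj_spec hne hcl hcv (x - γ • U (B x))).1
  set T := wproj W C (x - γ • U (B x))
  have e : x - z - (x - T) = T - z := by abel
  rw [e, inner_sub_left]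
  rw [← neg_sub T z, inner_neg_right, inner_neg_right] at h1
  nlinarith

/-- The fundamental estimate for one forward-backward step: `S` collects the slack in all the
inequalities that enter into the averagedness of the step, and it controls the residual. -/
theorem exists_slack (hW : IsMetric c d W) (hWU : ∀ v, W (U v) = v) (hβ : 0 < β)
    (hB : IsCocoercive β B) (hcl : IsClosed C) (hcv : Convex ℝ C) (hγ : 0 < γ)
    (hU : 0 < ‖U‖) (hγU : γ * ‖U‖ < 2 * β) (x : H) {z : H} (hz : z ∈ vipSolutions C B)
    {δ : ℝ} (hδ : δ = γ * ‖U‖ / (2 * β)) {r : H}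
    (hr : r = x - wproj W C (x - γ • U (B x))) :
    ∃ S : ℝ, 0 ≤ S ∧
      inner ℝ (W r) (x - z) = (1 - δ / 2) * wnorm W r ^ 2 + S ∧
      (1 - δ) * (δ / 2) * wnorm W r ^ 2 ≤ S + √(2 * S) * wnorm W (x - z - r) := by
  have hs2 := slack_nonneg (B := B) (γ := γ) hW hWU hcl hcv hγ x hz
  rw [← hr] at hs2
  have hco := hB x z
  set h := x - z with hh
  set w := B x - B z with hw
  set u := γ • U w with hu
  have hδ0 : 0 < δ := by rw [hδ]; positivity
  have hδ1 : δ < 1 := by rw [hδ, div_lt_one (by positivity)]; exact hγU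
  have hWu : ∀ v, inner ℝ (W u) v = γ * inner ℝ w v := fun v => by
    rw [hu, map_smul, hWU, real_inner_smul_left]
  have hqu : inner ℝ (W u) u ≤ 2 * δ * (γ * β * ‖w‖ ^ 2) := by
    have := inner_apply_self_le hWU w
    rw [hWU] at this
    rw [hWu, hu, real_inner_smul_right]
    have e : 2 * δ * (γ * β * ‖w‖ ^ 2) = γ * (γ * (‖U‖ * ‖w‖ ^ 2)) := by
      rw [hδ]; field_simp
    rw [e]; gcongr
  -- The slack splits into three parts: `s1` from cocoercivity, `s2` from the two variational
  -- inequalities, and `t` from completing a square, since 2δt dominates the squared weighted norm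
  -- of θ = δr - u.
  set t := γ * β * ‖w‖ ^ 2 - γ * inner ℝ w r + δ / 2 * wnorm W r ^ 2 with ht
  set s1 := γ * inner ℝ w h - γ * β * ‖w‖ ^ 2 with hs1
  set s2 := inner ℝ (W r) (h - r) - γ * inner ℝ w (h - r) with hs2'
  set θ := δ • r - u with hθ
  have hqr := hW.wnorm_sq r
  have hqθ : wnorm W θ ^ 2 ≤ 2 * δ * t := by
    rw [hW.wnorm_sq, hθ, hW.inner_sub_self, map_smul, real_inner_smul_left,
      real_inner_smul_left, real_inner_smul_right, hW.inner_comm r u, hWu r, ht, hqr]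
    nlinarith
  have ht0 : 0 ≤ t := by
    have := (sq_nonneg _).trans hqθ
    exact nonneg_of_mul_nonneg_right this (by linarith)
  have hs10 : 0 ≤ s1 := by
    have := mul_le_mul_of_nonneg_left hco hγ.le
    rw [real_inner_comm] at this; linarith
  have hWθ : ∀ v, inner ℝ (W θ) v = δ * inner ℝ (W r) v - γ * inner ℝ w v := fun v => by
    rw [hθ, map_sub, inner_sub_left, map_smul, real_inner_smul_left, hWu]
  refine ⟨s1 + s2 + t, by linarith, ?_, ?_⟩
  · rw [hs1, hs2', ht, hqr, inner_sub_right _ h r, inner_sub_right _ h r]; ring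
  -- Apart from multiples of the slacks only a pairing with θ remains, and θ itself has weighted
  -- norm at most √(2δt) ≤ √(2S).
  · have hid : (1 - δ) * (δ / 2) * wnorm W r ^ 2 =
        (1 - δ) * (s1 + t) - δ * s2 + inner ℝ (W θ) (h - r) := by
      rw [hWθ, hs1, hs2', ht, hqr]
      simp only [inner_sub_right]; ring
    have h1 := (abs_le.1 (hW.abs_inner_le θ (h - r))).2
    have h2 : wnorm W θ ≤ √(2 * (s1 + s2 + t)) := by
      refine Real.le_sqrt_of_sq_le (hqθ.trans ?_)
      nlinarith
    have h3 := mul_le_mul_of_nonneg_right h2 (wnorm_nonneg W (h - r))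
    rw [hid]
    nlinarith [mul_nonneg hδ0.le (add_nonneg hs10 ht0), mul_nonneg hδ0.le hs2]

/-- The same inequalities as in `exists_slack`, but the square ‖r - γU(Bx - Bz)‖² ≥ 0 is completed
so as to eliminate `r` and retain Bx - Bz. -/
theorem mul_norm_sub_sq_le (hW : IsMetric c d W) (hWU : ∀ v, W (U v) = v)
    (hB : IsCocoercive β B) (hcl : IsClosed C) (hcv : Convex ℝ C) (hγ : 0 < γ)
    (x : H) {z : H} (hz : z ∈ vipSolutions C B) {r : H}
    (hr : r = x - wproj W C (x - γ • U (B x))) :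
    γ * (2 * β - γ * ‖U‖) * ‖B x - B z‖ ^ 2 ≤
      wnorm W (x - z) ^ 2 - wnorm W (x - z - r) ^ 2 := by
  have hs2 := slack_nonneg (B := B) (γ := γ) hW hWU hcl hcv hγ x hz
  rw [← hr] at hs2
  have hco := mul_le_mul_of_nonneg_left (hB x z) hγ.le
  set h := x - z with hh
  set w := B x - B z with hw
  have h1 := inner_apply_self_le hWU w
  have h2 := hW.nonneg (r - γ • U w)
  rw [hWU] at h1
  rw [hW.inner_sub_self, hW.inner_comm r (γ • U w), map_smul, hWU, real_inner_smul_left,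
    real_inner_smul_left, real_inner_smul_right] at h2
  rw [hW.wnorm_sq, hW.wnorm_sq, hW.inner_sub_self h r]
  rw [inner_sub_right _ h r, inner_sub_right _ h r, hW.inner_comm r h] at hs2
  rw [real_inner_comm w h] at hco
  have h3 := mul_le_mul_of_nonneg_left h1 (sq_nonneg γ)
  nlinarith

end Step

/-! ### Weak convergence -/

section Weak

theorem weaklyConverges_iff [CompleteSpace H] {x : ℕ → H} {z : H} :
    WeaklyConverges x z ↔ ∀ v, Tendsto (fun k => inner ℝ (x k) v) atTop (𝓝 (inner ℝ z v)) := by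
  have hinj : Function.Injective (topDualPairing ℝ H).flip := by
    intro a b hab
    refine ext_inner_left ℝ fun v => ?_
    exact DFunLike.congr_fun hab (InnerProductSpace.toDual ℝ H v)
  refine (WeakBilin.tendsto_iff_forall_eval_tendsto _ hinj).trans ⟨fun h v => ?_, fun h f => ?_⟩
  · have := h (InnerProductSpace.toDual ℝ H v)
    simp only [real_inner_comm v]
    exact this
  · obtain ⟨v, rfl⟩ := (InnerProductSpace.toDual ℝ H).surjective f
    have := h v
    simp only [real_inner_comm v] at this
    exact this

/-- Banach-Alaoglu through the Riesz isomorphism. Ultrafilters take the place of weakly convergent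
subsequences, so separability plays no role. -/
theorem exists_weak_limit [CompleteSpace H] {x : ℕ → H} {M : ℝ} (hM : ∀ k, ‖x k‖ ≤ M)
    (F : Ultrafilter ℕ) :
    ∃ z, ∀ v, Tendsto (fun k => inner ℝ (x k) v) F (𝓝 (inner ℝ z v)) := by
  let φ : ℕ → WeakDual ℝ H := fun k => StrongDual.toWeakDual (InnerProductSpace.toDual ℝ H (x k))
  have hK := WeakDual.isCompact_closedBall (𝕜 := ℝ) (E := H) 0 M
  have hmem : ∀ k, φ k ∈ WeakDual.toStrongDual ⁻¹' Metric.closedBall (0 : StrongDual ℝ H) M := by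
    intro k
    simpa [φ] using hM k
  obtain ⟨f, -, hf⟩ := hK.ultrafilter_le_nhds (F.map φ)
    (by
      rw [le_principal_iff]
      exact Filter.mem_map.2 (Filter.Eventually.of_forall hmem))
  refine ⟨(InnerProductSpace.toDual ℝ H).symm (WeakDual.toStrongDual f), fun v => ?_⟩
  have h1 : Tendsto φ F (𝓝 f) := hf
  have h2 := ((WeakDual.eval_continuous v).tendsto f).comp h1
  rw [InnerProductSpace.toDual_symm_apply]
  exact h2

theorem mem_of_weak_limit [CompleteSpace H] {C : Set H} (hne : C.Nonempty) (hcl : IsClosed C)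
    (hcv : Convex ℝ C) {l : Filter ℕ} [l.NeBot] {p : ℕ → H} (hp : ∀ k, p k ∈ C) {z : H}
    (h : ∀ v, Tendsto (fun k => inner ℝ (p k) v) l (𝓝 (inner ℝ z v))) : z ∈ C := by
  obtain ⟨q, hq, hqC⟩ := exists_inner_sub_le_zero hne hcl hcv z
  have h1 : Tendsto (fun k => inner ℝ (p k) (z - q) - inner ℝ q (z - q)) l
      (𝓝 (inner ℝ z (z - q) - inner ℝ q (z - q))) := (h _).sub_const _
  have h2 : inner ℝ z (z - q) - inner ℝ q (z - q) ≤ 0 := by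
    refine le_of_tendsto h1 (Eventually.of_forall fun k => ?_)
    rw [← inner_sub_left, real_inner_comm]
    exact hqC _ (hp k)
  rw [← inner_sub_left, real_inner_self_eq_norm_sq] at h2
  have : z - q = 0 := norm_eq_zero.1 (pow_eq_zero_iff two_ne_zero |>.1
    (le_antisymm h2 (sq_nonneg _)))
  rwa [sub_eq_zero.1 this]

/-- Minty's lemma. -/
theorem mem_vipSolutions_of_minty {C : Set H} (hcv : Convex ℝ C) {B : H → H}
    (hBc : Continuous B) {z : H} (hz : z ∈ C)
    (h : ∀ y ∈ C, 0 ≤ inner ℝ (B y) (y - z)) : z ∈ vipSolutions C B := by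
  refine ⟨hz, fun y hy => ?_⟩
  have hlim : Tendsto (fun t : ℝ => inner ℝ (B (z + t • (y - z))) (y - z)) (𝓝[>] 0)
      (𝓝 (inner ℝ (B z) (y - z))) := by
    have hc : Continuous fun t : ℝ => inner ℝ (B (z + t • (y - z))) (y - z) := by fun_prop
    have := hc.tendsto 0
    simp only [zero_smul, add_zero] at this
    exact this.mono_left nhdsWithin_le_nhds
  refine ge_of_tendsto hlim ?_
  filter_upwards [Ioc_mem_nhdsGT (zero_lt_one' ℝ)] with t ht
  have h1 := h _ (hcv.add_smul_sub_mem hz hy ⟨ht.1.le, ht.2⟩)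
  rw [add_sub_cancel_left, real_inner_smul_right] at h1
  exact nonneg_of_mul_nonneg_right h1 ht.1

/-- Only weak convergence of `x` is available, so B(x k) cannot be passed to the limit. Monotonicity
moves `B` to the fixed point `y`: ⟪B y, y - x k⟫ is bounded below by a quantity tending to 0 with
the residual and is weakly continuous in x k. Minty's lemma then applies. -/
theorem mem_vipSolutions_of_weak_limit [CompleteSpace H] {C : Set H} (hcl : IsClosed C)
    (hcv : Convex ℝ C) {B : H → H} {β : ℝ} (hβ : 0 < β) (hB : IsCocoercive β B)
    {l : Filter ℕ} [l.NeBot] {x p : ℕ → H} {W : ℕ → H →L[ℝ] H} {γ : ℕ → ℝ} {M d γ₀ : ℝ}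
    (hM : ∀ k, ‖x k‖ ≤ M) (hp : ∀ k, p k ∈ C) (hγ₀ : 0 < γ₀) (hγ : ∀ k, γ₀ ≤ γ k)
    (hd : 0 ≤ d) (hW : ∀ k v, ‖W k v‖ ≤ d * ‖v‖)
    (hvi : ∀ k, ∀ y ∈ C, inner ℝ (W k (x k - p k)) (y - p k) ≤ γ k * inner ℝ (B (x k)) (y - p k))
    (hr : Tendsto (fun k => ‖x k - p k‖) l (𝓝 0)) {z : H}
    (hz : ∀ v, Tendsto (fun k => inner ℝ (x k) v) l (𝓝 (inner ℝ z v))) :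
    z ∈ vipSolutions C B := by
  have hne : C.Nonempty := ⟨p 0, hp 0⟩
  have hpz : ∀ v, Tendsto (fun k => inner ℝ (p k) v) l (𝓝 (inner ℝ z v)) := by
    intro v
    have h1 : Tendsto (fun k => inner ℝ (x k - p k) v) l (𝓝 0) := by
      refine squeeze_zero_norm (fun k => norm_inner_le_norm _ _) ?_
      simpa using hr.mul_const ‖v‖
    have h2 := (hz v).sub h1
    refine (h2.congr fun k => ?_).trans (by simp)
    rw [← inner_sub_left, sub_sub_cancel]
  refine mem_vipSolutions_of_minty hcv (hB.continuous hβ)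
    (mem_of_weak_limit hne hcl hcv hp hpz) fun y hy => ?_
  set K := ‖B 0‖ + 1 / β * M with hK
  have hBx : ∀ k, ‖B (x k)‖ ≤ K := by
    intro k
    have h1 := hB.norm_sub_le hβ (x k) 0
    rw [sub_zero] at h1
    have h2 : ‖B (x k)‖ ≤ ‖B 0‖ + ‖B (x k) - B 0‖ := norm_le_norm_add_norm_sub' _ _
    have h3 : 1 / β * ‖x k‖ ≤ 1 / β * M := by gcongr; exact hM k
    linarith
  have hlow : ∀ k, -(d / γ₀ * ‖x k - p k‖ * (‖y‖ + M + ‖x k - p k‖) + K * ‖x k - p k‖) ≤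
      inner ℝ (B y) y - inner ℝ (x k) (B y) := by
    intro k
    have h1 : 0 ≤ inner ℝ (B y - B (x k)) (y - x k) := by
      have := hB y (x k)
      rw [real_inner_comm]
      exact (by positivity : (0:ℝ) ≤ β * ‖B y - B (x k)‖ ^ 2).trans this
    have h2 := hvi k y hy
    have h3 : ‖y - p k‖ ≤ ‖y‖ + M + ‖x k - p k‖ := by
      have e : y - p k = y - x k + (x k - p k) := by abel
      rw [e]
      have := norm_sub_le y (x k)
      linarith [norm_add_le (y - x k) (x k - p k), hM k]
    have h4 : -(d * ‖x k - p k‖ * (‖y‖ + M + ‖x k - p k‖)) ≤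
        inner ℝ (W k (x k - p k)) (y - p k) := by
      have h5 := (abs_le.1 (abs_real_inner_le_norm (W k (x k - p k)) (y - p k))).1
      have h6 : ‖W k (x k - p k)‖ * ‖y - p k‖ ≤
          d * ‖x k - p k‖ * (‖y‖ + M + ‖x k - p k‖) :=
        mul_le_mul (hW k _) h3 (norm_nonneg _) (by positivity)
      linarith
    have hγk := hγ₀.trans_le (hγ k)
    have h7 : -(d / γ₀ * ‖x k - p k‖ * (‖y‖ + M + ‖x k - p k‖)) ≤
        inner ℝ (B (x k)) (y - p k) := by
      have hQ : 0 ≤ d * ‖x k - p k‖ * (‖y‖ + M + ‖x k - p k‖) := by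
        have := (norm_nonneg _).trans h3
        positivity
      have h8 : -(d * ‖x k - p k‖ * (‖y‖ + M + ‖x k - p k‖)) ≤
        γ k * inner ℝ (B (x k)) (y - p k) := h4.trans h2
      have e : d / γ₀ * ‖x k - p k‖ * (‖y‖ + M + ‖x k - p k‖) =
        d * ‖x k - p k‖ * (‖y‖ + M + ‖x k - p k‖) / γ₀ := by ring
      rw [e]
      -- A violation would make the inner product negative, and then replacing γ₀ by the larger γ k
      -- only lowers the product, contradicting the bound before division.
      by_contra hcon
      rw [not_le] at hcon
      set Q := d * ‖x k - p k‖ * (‖y‖ + M + ‖x k - p k‖)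
      have h9 : inner ℝ (B (x k)) (y - p k) * γ₀ < -Q := by
        have := mul_lt_mul_of_pos_right hcon hγ₀
        rwa [neg_mul, div_mul_cancel₀ _ hγ₀.ne'] at this
      have h10 : inner ℝ (B (x k)) (y - p k) < 0 := by
        refine hcon.trans_le ?_
        have : 0 ≤ Q / γ₀ := by positivity
        linarith
      nlinarith [hγ k]
    have h11 : -(K * ‖x k - p k‖) ≤ inner ℝ (B (x k)) (p k - x k) := by
      have h5 := (abs_le.1 (abs_real_inner_le_norm (B (x k)) (p k - x k))).1
      rw [norm_sub_rev (p k)] at h5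
      have := mul_le_mul_of_nonneg_right (hBx k) (norm_nonneg (x k - p k))
      linarith
    rw [inner_sub_left] at h1
    have e1 : inner ℝ (B (x k)) (y - x k) =
        inner ℝ (B (x k)) (y - p k) + inner ℝ (B (x k)) (p k - x k) := by
      rw [← inner_add_right]; congr 1; abel
    have e2 : inner ℝ (B y) (y - x k) = inner ℝ (B y) y - inner ℝ (x k) (B y) := by
      rw [inner_sub_right, real_inner_comm (x k)]
    linarith
  have hl : Tendsto (fun k => -(d / γ₀ * ‖x k - p k‖ * (‖y‖ + M + ‖x k - p k‖) +
      K * ‖x k - p k‖)) l (𝓝 0) := by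
    have := (((hr.const_mul (d / γ₀)).mul (hr.const_add (‖y‖ + M))).add (hr.const_mul K)).neg
    simpa using this
  have h12 : Tendsto (fun k => inner ℝ (B y) y - inner ℝ (x k) (B y)) l
      (𝓝 (inner ℝ (B y) y - inner ℝ z (B y))) := (hz _).const_sub _
  have := le_of_tendsto_of_tendsto' hl h12 hlow
  rwa [inner_sub_right, real_inner_comm z]

/-- An Opial-type lemma for a variable metric. -/
theorem exists_weaklyConverges [CompleteSpace H] {Ω : Set H} {x : ℕ → H} {M c d : ℝ}
    (hM : ∀ k, ‖x k‖ ≤ M) {W : ℕ → H →L[ℝ] H} (hW : ∀ k, IsMetric c d (W k))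
    (hWlim : ∀ v, ∃ L, Tendsto (fun k => W k v) atTop (𝓝 L))
    (hlim : ∀ z ∈ Ω, ∃ l : ℝ, Tendsto (fun k => wnorm (W k) (x k - z)) atTop (𝓝 l))
    (hcl : ∀ F : Ultrafilter ℕ, (F : Filter ℕ) ≤ atTop → ∀ z,
      (∀ v, Tendsto (fun k => inner ℝ (x k) v) F (𝓝 (inner ℝ z v))) → z ∈ Ω) :
    ∃ z ∈ Ω, WeaklyConverges x z := by
  have huniq : ∀ F G : Ultrafilter ℕ, (F : Filter ℕ) ≤ atTop → (G : Filter ℕ) ≤ atTop →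
      ∀ z z', (∀ v, Tendsto (fun k => inner ℝ (x k) v) F (𝓝 (inner ℝ z v))) →
        (∀ v, Tendsto (fun k => inner ℝ (x k) v) G (𝓝 (inner ℝ z' v))) → z = z' := by
    intro F G hF hG z z' hz hz'
    obtain ⟨l, hl⟩ := hlim z (hcl F hF z hz)
    obtain ⟨l', hl'⟩ := hlim z' (hcl G hG z' hz')
    obtain ⟨L, hL⟩ := hWlim (z - z')
    obtain ⟨A, hA⟩ := hWlim z
    obtain ⟨A', hA'⟩ := hWlim z'
    have hA2 := hA.inner (𝕜 := ℝ) (tendsto_const_nhds (x := z))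
    have hA2' := hA'.inner (𝕜 := ℝ) (tendsto_const_nhds (x := z'))
    -- Polarization: the difference of the squared weighted distances from x k to z' and z is affine
    -- in x k, with linear part twice this pairing, and the remaining terms converge because W k z
    -- and W k z' do.
    obtain ⟨m, hm⟩ : ∃ m : ℝ, Tendsto (fun k => inner ℝ (x k) (W k (z - z'))) atTop (𝓝 m) := by
      refine ⟨_, (((hl'.pow 2).sub (hl.pow 2)).add (hA2.sub hA2') |>.div_const 2).congr
        fun k => ?_⟩
      rw [(hW k).wnorm_sq, (hW k).wnorm_sq, (hW k).inner_sub_self, (hW k).inner_sub_self,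
        ← (hW k).symm, inner_sub_right]
      ring
    have hstep : ∀ E : Ultrafilter ℕ, (E : Filter ℕ) ≤ atTop → ∀ y,
        (∀ v, Tendsto (fun k => inner ℝ (x k) v) E (𝓝 (inner ℝ y v))) → inner ℝ y L = m := by
      intro E hE y hy
      have h1 : Tendsto (fun k => inner ℝ (x k) (W k (z - z') - L)) E (𝓝 0) := by
        refine squeeze_zero_norm (a := fun k => M * ‖W k (z - z') - L‖) (fun k => ?_) ?_
        · exact (norm_inner_le_norm _ _).trans
            (mul_le_mul_of_nonneg_right (hM k) (norm_nonneg _))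
        · have := ((hL.mono_left hE).sub_const L).norm.const_mul M
          simpa using this
      have h2 := (hy L).add h1
      rw [add_zero] at h2
      refine tendsto_nhds_unique h2 ((hm.mono_left hE).congr fun k => ?_)
      rw [← inner_add_right, add_sub_cancel]
    have h0 : inner ℝ (z - z') L = 0 := by
      rw [inner_sub_left, hstep F hF z hz, hstep G hG z' hz', sub_self]
    have h1 : c * ‖z - z'‖ ^ 2 ≤ inner ℝ L (z - z') :=
      ge_of_tendsto (hL.inner tendsto_const_nhds)
        (Eventually.of_forall fun k => (hW k).lower (z - z'))
    rw [real_inner_comm, h0] at h1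
    have h2 := nonpos_of_mul_nonpos_right h1 (hW 0).pos
    exact sub_eq_zero.1 (norm_eq_zero.1 (pow_eq_zero_iff two_ne_zero |>.1
      (le_antisymm h2 (sq_nonneg _))))
  have hhyp : ((hyperfilter ℕ : Ultrafilter ℕ) : Filter ℕ) ≤ atTop := by
    rw [← Nat.cofinite_eq_atTop]; exact hyperfilter_le_cofinite
  obtain ⟨z, hz⟩ := exists_weak_limit hM (hyperfilter ℕ)
  refine ⟨z, hcl _ hhyp z hz, weaklyConverges_iff.2 fun v => ?_⟩
  rw [tendsto_iff_ultrafilter]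
  intro G hG
  obtain ⟨z', hz'⟩ := exists_weak_limit hM G
  rw [huniq _ G hhyp hG z z' hz hz']
  exact hz' v

end Weak

/-! ### Strong convergence of the metrics -/

/-- Dividing W k by the convergent product of the factors 1 + η j with j < k yields a decreasing
sequence of nonnegative operators. Its quadratic forms converge, and `norm_sq_apply_le_of_nonneg`
applied to differences makes the operators converge strongly. -/
theorem exists_tendsto_metric [CompleteSpace H] {c d : ℝ} {W : ℕ → H →L[ℝ] H}
    (hW : ∀ k, IsMetric c d (W k)) {η : ℕ → ℝ} (hη : ∀ k, 0 ≤ η k) (hηs : Summable η)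
    (hmono : ∀ k x, inner ℝ (W (k + 1) x) x ≤ (1 + η k) * inner ℝ (W k x) x) (v : H) :
    ∃ L, Tendsto (fun k => W k v) atTop (𝓝 L) := by
  set p : ℕ → ℝ := fun k => ∏ j ∈ Finset.range k, (1 + η j) with hp
  have hp1 : ∀ k, 1 ≤ p k := fun k => (prod_one_add_bounds hη hηs k).1
  have hp0 : ∀ k, 0 < p k := fun k => one_pos.trans_le (hp1 k)
  have hplim : ∃ l : ℝ, Tendsto p atTop (𝓝 l) :=
    ⟨_, tendsto_atTop_ciSup (monotone_nat_of_le_succ fun k => by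
      rw [hp]; simp only [Finset.prod_range_succ]
      exact le_mul_of_one_le_right (hp0 k).le (by linarith [hη k]))
      ⟨_, by rintro _ ⟨k, rfl⟩; exact (prod_one_add_bounds hη hηs k).2⟩⟩
  set A : ℕ → H →L[ℝ] H := fun k => (p k)⁻¹ • W k with hA
  have hAs : ∀ k x y, inner ℝ (A k x) y = inner ℝ x (A k y) := fun k x y => by
    simp only [hA, smul_apply, real_inner_smul_left, real_inner_smul_right,
      (hW k).symm]
  have hAq : ∀ k x, inner ℝ (A k x) x = (p k)⁻¹ * inner ℝ (W k x) x := fun k x => by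
    simp only [hA, smul_apply, real_inner_smul_left]
  have hA0 : ∀ k x, 0 ≤ inner ℝ (A k x) x := fun k x => by
    rw [hAq]; exact mul_nonneg (inv_nonneg.2 (hp0 k).le) ((hW k).nonneg x)
  have hAanti : ∀ x, Antitone fun k => inner ℝ (A k x) x := fun x =>
    antitone_nat_of_succ_le fun k => by
      rw [hAq, hAq]
      have e : p (k + 1) = p k * (1 + η k) := by simp only [hp, Finset.prod_range_succ]
      have h1 : 0 < 1 + η k := by linarith [hη k]
      have h2 := hp0 k
      rw [e, inv_mul_eq_div, inv_mul_eq_div, div_le_div_iff₀ (by positivity) h2]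
      nlinarith [mul_le_mul_of_nonneg_left (hmono k x) h2.le]
  have hdiff : ∀ m n, m ≤ n → ‖A m v - A n v‖ ^ 2 ≤
      d * (inner ℝ (A m v) v - inner ℝ (A n v) v) := by
    intro m n hmn
    have h := norm_sq_apply_le_of_nonneg (W := A m - A n) (K := d)
      (fun x y => by simp only [sub_apply, inner_sub_left, inner_sub_right, hAs])
      (fun x => by
        rw [sub_apply, inner_sub_left]
        exact sub_nonneg.2 (hAanti x hmn))
      (fun x => by
        rw [sub_apply, inner_sub_left]
        have h1 : inner ℝ (A m x) x ≤ inner ℝ (W m x) x := by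
          rw [hAq]
          exact mul_le_of_le_one_left ((hW m).nonneg x) (inv_le_one_of_one_le₀ (hp1 m))
        linarith [hA0 n x, (hW m).upper_inner x]) v
    rwa [sub_apply, inner_sub_left] at h
  have hq : CauchySeq fun k => inner ℝ (A k v) v :=
    (tendsto_atTop_ciInf (hAanti v) ⟨0, by rintro _ ⟨k, rfl⟩; exact hA0 k v⟩).cauchySeq
  have hcau : CauchySeq fun k => A k v := by
    rw [Metric.cauchySeq_iff'] at hq ⊢
    intro ε hε
    obtain ⟨N, hN⟩ := hq (ε ^ 2 / (|d| + 1)) (by positivity)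
    refine ⟨N, fun n hn => ?_⟩
    have h1 := hdiff N n hn
    have h2 := hN n hn
    rw [Real.dist_eq, abs_sub_comm, abs_of_nonneg (sub_nonneg.2 (hAanti v hn)),
      lt_div_iff₀ (by positivity)] at h2
    rw [dist_eq_norm, norm_sub_rev]
    refine lt_of_pow_lt_pow_left₀ 2 hε.le ?_
    have h3 : 0 ≤ inner ℝ (A N v) v - inner ℝ (A n v) v := sub_nonneg.2 (hAanti v hn)
    nlinarith [mul_le_mul_of_nonneg_right (le_abs_self d) h3]
  obtain ⟨L, hL⟩ := cauchySeq_tendsto_of_complete hcau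
  obtain ⟨l, hl⟩ := hplim
  refine ⟨l • L, (hl.smul hL).congr fun k => ?_⟩
  simp only [hA, smul_apply]
  rw [smul_smul, mul_inv_cancel₀ (hp0 k).ne', one_smul]

/-! ### Further lemmas on real sequences -/

theorem Tendsto.bddAbove_nat {u : ℕ → ℝ} {l : ℝ} (h : Tendsto u atTop (𝓝 l)) :
    ∃ M, 0 < M ∧ ∀ k, u k ≤ M := by
  obtain ⟨M, hM⟩ := h.bddAbove_range
  exact ⟨max M 1, by positivity, fun k => (hM ⟨k, rfl⟩).trans (le_max_left _ _)⟩

/-- Here `v` is the distance to a solution, `t` the distance after the exact step and `e` the error.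
The recursion in unsquared distances gives convergence, hence boundedness; only then can it be
squared with all cross terms summable, after which `D` telescopes. -/
theorem exists_tendsto_and_summable {v t e η D : ℕ → ℝ} (hv : ∀ k, 0 ≤ v k) (ht : ∀ k, 0 ≤ t k)
    (he : ∀ k, 0 ≤ e k) (hes : Summable e) (hη : ∀ k, 0 ≤ η k) (hηs : Summable η)
    (hD : ∀ k, 0 ≤ D k) (htv : ∀ k, t k ^ 2 = v k ^ 2 - D k)
    (h : ∀ k, v (k + 1) ≤ (1 + η k) * (t k + e k)) :
    (∃ l : ℝ, Tendsto v atTop (𝓝 l)) ∧ Summable D := by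
  have htle : ∀ k, t k ≤ v k := fun k =>
    le_of_sq_le_sq (by linarith [htv k, hD k]) (hv k)
  have hlim : ∃ l : ℝ, Tendsto v atTop (𝓝 l) :=
    exists_tendsto_of_le_mul_add hv hη hηs he hes fun k =>
      (h k).trans (mul_le_mul_of_nonneg_left (by linarith [htle k]) (by linarith [hη k]))
  refine ⟨hlim, ?_⟩
  obtain ⟨l, hl⟩ := hlim
  obtain ⟨V, hV0, hV⟩ := Tendsto.bddAbove_nat hl
  obtain ⟨E, hE0, hE⟩ := Tendsto.bddAbove_nat hes.tendsto_atTop_zero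
  obtain ⟨N, hN0, hN⟩ := Tendsto.bddAbove_nat hηs.tendsto_atTop_zero
  refine summable_of_le_sub_add (V := fun k => v k ^ 2) (fun k => sq_nonneg _) hD
    (c := fun k => (2 * V + E) * e k + (2 + N) * (V + E) ^ 2 * η k)
    ((hes.mul_left _).add (hηs.mul_left _)) fun k => ?_
  have h0 := ht k
  have h1 := he k
  have h2 := hη k
  have h3 : v (k + 1) ^ 2 ≤ ((1 + η k) * (t k + e k)) ^ 2 := pow_le_pow_left₀ (hv _) (h k) 2
  have h4 : (t k + e k) ^ 2 ≤ (V + E) ^ 2 :=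
    pow_le_pow_left₀ (by positivity) (add_le_add ((htle k).trans (hV k)) (hE k)) 2
  have h5 : (2 * η k + η k ^ 2) * (t k + e k) ^ 2 ≤ ((2 + N) * η k) * (V + E) ^ 2 :=
    mul_le_mul (by nlinarith [hN k]) h4 (sq_nonneg _) (by positivity)
  have h6 : 2 * t k * e k + e k ^ 2 ≤ (2 * V + E) * e k := by
    nlinarith [mul_le_mul_of_nonneg_right ((htle k).trans (hV k)) h1,
      mul_le_mul_of_nonneg_right (hE k) h1]
  nlinarith [htv k]

/-- Raised to the fourth power, the recursion has increments bounded by a multiple of t ρ⁴ plus a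
summable error, so ρ⁴ converges. A positive limit would make `t` summable. -/
theorem tendsto_zero_of_summable_mul_pow {ρ t e : ℕ → ℝ} {L Λ R : ℝ} (hρ : ∀ k, 0 ≤ ρ k)
    (hρR : ∀ k, ρ k ≤ R) (hL : 0 ≤ L) (ht : ∀ k, 0 ≤ t k) (htΛ : ∀ k, t k ≤ Λ)
    (htn : ¬ Summable t) (he : ∀ k, 0 ≤ e k) (hes : Summable e)
    (h : ∀ k, ρ (k + 1) ≤ ρ k + L * (t k * ρ k) + e k)
    (hs : Summable fun k => t k * ρ k ^ 4) : Tendsto ρ atTop (𝓝 0) := by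
  obtain ⟨E, hE0, hE⟩ := Tendsto.bddAbove_nat hes.tendsto_atTop_zero
  have hΛ : 0 ≤ Λ := (ht 0).trans (htΛ 0)
  have hR : 0 ≤ R := (hρ 0).trans (hρR 0)
  set Y := L * Λ with hY
  have hY0 : 0 ≤ Y := mul_nonneg hL hΛ
  set R' := R * (1 + Y) + E with hR'
  have hR'0 : 0 ≤ R' := by positivity
  obtain ⟨l, hl⟩ : ∃ l : ℝ, Tendsto (fun k => ρ k ^ 4) atTop (𝓝 l) := by
    refine exists_tendsto_of_le_add (fun k => by have := hρ k; positivity)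
      -- The polynomial comes from (1 + y)⁴ - 1 = y(4 + 6y + 4y² + y³) with y = L t k ≤ Y; the last
      -- term bounds the effect of adding e k to a base when the sum stays below R'.
      (c := fun k => L * (4 + 6 * Y + 4 * Y ^ 2 + Y ^ 3) * (t k * ρ k ^ 4) + 4 * R' ^ 3 * e k)
      ((hs.mul_left _).add (hes.mul_left _)) fun k => ?_
    have h0 := hρ k
    have h1 := ht k
    have h2 := he k
    set y := L * t k with hy
    have hy0 : 0 ≤ y := mul_nonneg hL h1
    have hyY : y ≤ Y := mul_le_mul_of_nonneg_left (htΛ k) hL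
    set A := ρ k * (1 + y) with hA
    have hA0 : 0 ≤ A := by positivity
    have hle : ρ (k + 1) ≤ A + e k := (h k).trans_eq (by rw [hA, hy]; ring)
    have hAe : A + e k ≤ R' := by
      refine add_le_add ?_ (hE k)
      exact mul_le_mul (hρR k) (by linarith) (by linarith) hR
    have h3 : ρ (k + 1) ^ 4 ≤ (A + e k) ^ 4 := pow_le_pow_left₀ (hρ _) hle 4
    have h4 : (A + e k) ^ 4 ≤ A ^ 4 + 4 * R' ^ 3 * e k := by
      have e1 : (A + e k) ^ 4 - A ^ 4 =
          e k * ((A + e k) ^ 3 + (A + e k) ^ 2 * A + (A + e k) * A ^ 2 + A ^ 3) := by ring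
      have hAR : A ≤ R' := by linarith
      have e2 : (A + e k) ^ 3 + (A + e k) ^ 2 * A + (A + e k) * A ^ 2 + A ^ 3 ≤
          R' ^ 3 + R' ^ 2 * R' + R' * R' ^ 2 + R' ^ 3 := by gcongr
      have e3 := mul_le_mul_of_nonneg_left e2 h2
      linarith
    have h5 : A ^ 4 ≤ ρ k ^ 4 + L * (4 + 6 * Y + 4 * Y ^ 2 + Y ^ 3) * (t k * ρ k ^ 4) := by
      have e1 : A ^ 4 = ρ k ^ 4 + L * (4 + 6 * y + 4 * y ^ 2 + y ^ 3) * (t k * ρ k ^ 4) := by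
        rw [hA, hy]; ring
      rw [e1]
      gcongr
    linarith
  have hl0 : l = 0 := by
    by_contra hne
    have hlpos : 0 < l := lt_of_le_of_ne
      (ge_of_tendsto' hl fun k => by have := hρ k; positivity) (Ne.symm hne)
    refine htn (Summable.of_norm_bounded_eventually_nat
      (g := fun k => 2 / l * (t k * ρ k ^ 4)) (hs.mul_left _) ?_)
    filter_upwards [hl.eventually (lt_mem_nhds (half_lt_self hlpos))] with k hk
    rw [Real.norm_eq_abs, abs_of_nonneg (ht k), div_mul_eq_mul_div, le_div_iff₀ hlpos]
    nlinarith [ht k]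
  rw [hl0] at hl
  have := (Real.continuous_sqrt.comp Real.continuous_sqrt).tendsto 0 |>.comp hl
  simp only [Function.comp_def, Real.sqrt_zero] at this
  refine this.congr fun k => ?_
  have e1 : ρ k ^ 4 = (ρ k ^ 2) ^ 2 := by ring
  rw [e1, Real.sqrt_sq (sq_nonneg _), Real.sqrt_sq (hρ k)]

theorem tendsto_zero_of_sq {u : ℕ → ℝ} (h : Tendsto (fun k => u k ^ 2) atTop (𝓝 0)) :
    Tendsto u atTop (𝓝 0) := by
  rw [tendsto_zero_iff_abs_tendsto_zero]
  have := Real.continuous_sqrt.tendsto 0 |>.comp h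
  simp only [Function.comp_def, Real.sqrt_zero, Real.sqrt_sq_eq_abs] at this
  exact this

/-! ### Residuals -/

/-- Expanding the last hypothesis gives c‖r‖² ≤ ⟪u, r⟫ ≤ ⟪u, r'⟫ + ⟪u', r⟫ ≤ 2d‖r‖‖r'‖. -/
theorem norm_le_of_inner_sub_nonpos {c d : ℝ} (hc : 0 < c) {u u' r r' : H}
    (h1 : c * ‖r‖ ^ 2 ≤ inner ℝ u r) (h2 : 0 ≤ inner ℝ u' r')
    (h3 : ‖u‖ ≤ d * ‖r‖) (h4 : ‖u'‖ ≤ d * ‖r'‖) (h : inner ℝ (u - u') (r - r') ≤ 0) :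
    ‖r‖ ≤ 2 * d / c * ‖r'‖ := by
  rw [inner_sub_left, inner_sub_right, inner_sub_right] at h
  have h5 := real_inner_le_norm u r'
  have h6 := real_inner_le_norm u' r
  have h7 := mul_le_mul_of_nonneg_right h3 (norm_nonneg r')
  have h8 := mul_le_mul_of_nonneg_right h4 (norm_nonneg r)
  rw [div_mul_eq_mul_div, le_div_iff₀ hc]
  rcases eq_or_ne ‖r‖ 0 with h0 | h0
  · rw [h0] at h3 ⊢
    have : 0 ≤ d * ‖r'‖ := (norm_nonneg _).trans h4
    linarith
  · have : 0 < ‖r‖ := lt_of_le_of_ne (norm_nonneg _) h0.symm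
    nlinarith

theorem wnorm_id (x : H) : wnorm (ContinuousLinearMap.id ℝ H) x = ‖x‖ := by
  simp [wnorm]

section Reference
variable [CompleteSpace H]

/-- The forward-backward residual with unit step size for the original metric. -/
noncomputable def residual (C : Set H) (B : H → H) (x : H) : H :=
  x - wproj (ContinuousLinearMap.id ℝ H) C (x - B x)

/-- Unit step size may be too long for the reference map to be nonexpansive; all that matters is a
Lipschitz constant independent of the iteration. -/
theorem norm_residual_sub_le {C : Set H} (hne : C.Nonempty) (hcl : IsClosed C)
    (hcv : Convex ℝ C) {B : H → H} {β : ℝ} (hβ : 0 < β) (hB : IsCocoercive β B) (x y : H) :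
    ‖residual C B x - residual C B y‖ ≤ (2 + 1 / β) * ‖x - y‖ := by
  have h1 := isMetric_id.wnorm_wproj_sub_le hne hcl hcv (x - B x) (y - B y)
  rw [wnorm_id, wnorm_id] at h1
  have e1 : x - B x - (y - B y) = (x - y) - (B x - B y) := by abel
  rw [e1] at h1
  have h2 := norm_sub_le (x - y) (B x - B y)
  have h3 := hB.norm_sub_le hβ x y
  rw [residual, residual, sub_sub_sub_comm]
  have h4 := norm_sub_le (x - y) (wproj (ContinuousLinearMap.id ℝ H) C (x - B x) -
    wproj (ContinuousLinearMap.id ℝ H) C (y - B y))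
  linarith

/-- For the two projected points p and q, both γ⁻¹W(x - p) - B x and (x - q) - B x, up to sign
conventions, are normal vectors of `C` at p and q. Monotonicity of the normal cone cancels B x and
compares the residuals, uniformly over the metrics and step sizes in the given ranges. -/
theorem residual_equiv {C : Set H} (hne : C.Nonempty) (hcl : IsClosed C) (hcv : Convex ℝ C)
    {c d g G : ℝ} (hg : 0 < g) (hG : 0 < G) (hc : 0 < c) :
    ∃ K, 0 ≤ K ∧ ∀ (B : H → H) (W U : H →L[ℝ] H) (γ : ℝ), IsMetric c d W → (∀ v, W (U v) = v) →
      g ≤ γ → γ ≤ G → ∀ x,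
      ‖x - wproj W C (x - γ • U (B x))‖ ≤ K * ‖residual C B x‖ ∧
        ‖residual C B x‖ ≤ K * ‖x - wproj W C (x - γ • U (B x))‖ := by
  -- These constants bound γ⁻¹W and the identity simultaneously, so the comparison can be applied in
  -- both directions.
  set c' := min (c / G) 1 with hc'
  set d' := max (d / g) 1 with hd'
  have hc'0 : 0 < c' := lt_min (by positivity) one_pos
  have hd'0 : 0 < d' := lt_of_lt_of_le one_pos (le_max_right _ _)
  refine ⟨2 * d' / c', by positivity, fun B W U γ hW hWU hgγ hγG x => ?_⟩
  have hγ : 0 < γ := hg.trans_le hgγ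
  set p := wproj W C (x - γ • U (B x)) with hp
  set q := wproj (ContinuousLinearMap.id ℝ H) C (x - B x) with hq
  have hpC : p ∈ C := (hW.wproj_spec hne hcl hcv _).1
  have hqC : q ∈ C := (isMetric_id.wproj_spec hne hcl hcv _).1
  have v1 := forwardBackward_inner_nonneg (B := B) (γ := γ) hW hWU hne hcl hcv x hqC
  have v2 := (isMetric_id.wproj_spec hne hcl hcv (x - B x)).2 p hpC
  rw [← hp] at v1
  rw [← hq, ContinuousLinearMap.id_apply] at v2
  set u := γ⁻¹ • W (x - p) with hu
  have hres : residual C B x = x - q := rfl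
  rw [hres]
  have a1 : c' * ‖x - p‖ ^ 2 ≤ inner ℝ u (x - p) := by
    rw [hu, real_inner_smul_left, inv_mul_eq_div, le_div_iff₀ hγ]
    have h1 : c' * γ ≤ c := by
      calc c' * γ ≤ c / G * G := mul_le_mul (min_le_left _ _) hγG hγ.le (by positivity)
        _ = c := div_mul_cancel₀ _ hG.ne'
    nlinarith [hW.lower (x - p), mul_le_mul_of_nonneg_right h1 (sq_nonneg ‖x - p‖)]
  have a2 : c' * ‖x - q‖ ^ 2 ≤ inner ℝ (x - q) (x - q) := by
    rw [real_inner_self_eq_norm_sq]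
    exact mul_le_of_le_one_left (sq_nonneg _) (min_le_right _ _)
  have a3 : ‖u‖ ≤ d' * ‖x - p‖ := by
    rw [hu, norm_smul, norm_inv, Real.norm_of_nonneg hγ.le, inv_mul_eq_div, div_le_iff₀ hγ]
    have h1 : d ≤ d' * γ := by
      calc d = d / g * g := (div_mul_cancel₀ _ hg.ne').symm
        _ ≤ d' * γ := mul_le_mul (le_max_left _ _) hgγ hg.le hd'0.le
    nlinarith [hW.upper (x - p), mul_le_mul_of_nonneg_right h1 (norm_nonneg (x - p))]
  have a4 : ‖x - q‖ ≤ d' * ‖x - q‖ := le_mul_of_one_le_left (norm_nonneg _) (le_max_right _ _)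
  have a5 : inner ℝ (u - (x - q)) (x - p - (x - q)) ≤ 0 := by
    have e1 : x - p - (x - q) = q - p := by abel
    have v3 : inner ℝ u (q - p) ≤ inner ℝ (B x) (q - p) := by
      rw [hu, real_inner_smul_left, inv_mul_eq_div, div_le_iff₀ hγ]
      linarith
    rw [sub_right_comm, inner_sub_left, ← neg_sub q p, inner_neg_right, inner_neg_right] at v2
    rw [e1, inner_sub_left]
    linarith
  have n1 : 0 ≤ inner ℝ u (x - p) := (by positivity : 0 ≤ c' * ‖x - p‖ ^ 2).trans a1
  have n2 : 0 ≤ inner ℝ (x - q) (x - q) := real_inner_self_nonneg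
  refine ⟨norm_le_of_inner_sub_nonpos hc'0 a1 n2 a3 a4 a5,
    norm_le_of_inner_sub_nonpos hc'0 a2 n1 a4 a3 ?_⟩
  rw [← neg_sub u, ← neg_sub (x - p), inner_neg_neg]
  exact a5

end Reference

/-! ### The iteration -/

/-- The data of a variable metric forward-backward iteration with errors. -/
structure IsIteration [CompleteSpace H] (C : Set H) (B : H → H) (β α K : ℝ) (η : ℕ → ℝ)
    (U : ℕ → H →L[ℝ] H) (γ lam : ℕ → ℝ) (a b x : ℕ → H) : Prop where
  closed : IsClosed C
  convex : Convex ℝ C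
  beta_pos : 0 < β
  cocoercive : IsCocoercive β B
  solvable : (vipSolutions C B).Nonempty
  alpha_pos : 0 < α
  eta_nonneg : ∀ k, 0 ≤ η k
  eta_summable : Summable η
  metric : ∀ k, U k ∈ strongPos α
  norm_le : ∀ k, ‖U k‖ ≤ K
  mono : ∀ k, U k ≤ (1 + η k) • U (k + 1)
  gamma_pos : ∀ k, 0 < γ k
  gamma_lt : ∀ k, γ k * ‖U k‖ < 2 * β
  lam_pos : ∀ k, 0 < lam k
  lam_lt : ∀ k, lam k < 1 / avgConst β (γ k) (U k)
  summable_a : Summable fun k => lam k * ‖a k‖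
  summable_b : Summable fun k => lam k * ‖b k‖
  step : ∀ k, x (k + 1) = x k +
    lam k • (wproj (U k).inverse C (x k - γ k • U k (B (x k) + b k)) + a k - x k)

/-- The residual of the `k`-th exact forward-backward step. -/
noncomputable def stepResidual (C : Set H) (B : H → H) (U : ℕ → H →L[ℝ] H) (γ : ℕ → ℝ)
    (x : ℕ → H) (k : ℕ) : H :=
  x k - wproj (U k).inverse C (x k - γ k • U k (B (x k)))

theorem one_div_avgConst {β : ℝ} (hβ : 0 < β) (γ : ℝ) (U : H →L[ℝ] H) :
    1 / avgConst β γ U = 2 - γ * ‖U‖ / (2 * β) := by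
  rw [avgConst, one_div_div]; field_simp; ring

theorem alpha_le_norm [CompleteSpace H] [Nontrivial H] {α : ℝ} {U : H →L[ℝ] H}
    (hU : U ∈ strongPos α) : α ≤ ‖U‖ := by
  obtain ⟨v, hv⟩ := exists_ne (0 : H)
  have h1 := mul_norm_sq_le_inner hU v
  have h2 : inner ℝ (U v) v ≤ ‖U‖ * ‖v‖ ^ 2 :=
    calc _ ≤ ‖U v‖ * ‖v‖ := real_inner_le_norm _ _
      _ ≤ ‖U‖ * ‖v‖ * ‖v‖ := by gcongr; exact U.le_opNorm v
      _ = _ := by ring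
  exact le_of_mul_le_mul_right (h1.trans h2) (by positivity)

namespace IsIteration
variable [CompleteSpace H] {C : Set H} {B : H → H} {β α K : ℝ} {η : ℕ → ℝ}
  {U : ℕ → H →L[ℝ] H} {γ lam : ℕ → ℝ} {a b x : ℕ → H}

theorem nonempty (h : IsIteration C B β α K η U γ lam a b x) : C.Nonempty :=
  let ⟨z, hz⟩ := h.solvable
  ⟨z, hz.1⟩

theorem wnorm_succ_le (h : IsIteration C B β α K η U γ lam a b x) (k : ℕ) (v : H) :
    wnorm (U (k + 1)).inverse v ≤ (1 + η k) * wnorm (U k).inverse v := by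
  have hη := h.eta_nonneg k
  have hK : ∀ j, ‖U j‖ ≤ max K 1 := fun j => (h.norm_le j).trans (le_max_left _ _)
  have hm := fun j => isMetric_inverse h.alpha_pos (h.metric j) (by positivity) (hK j)
  have h1 := inner_inverse_le h.alpha_pos (h.metric k) (h.metric (k + 1)) (by positivity)
    (h.mono k) v
  refine le_of_sq_le_sq ?_ (mul_nonneg (by linarith) (wnorm_nonneg _ _))
  rw [mul_pow, (hm _).wnorm_sq, (hm _).wnorm_sq]
  have := (hm k).nonneg v
  nlinarith [mul_nonneg (mul_nonneg hη (by linarith : 0 ≤ 1 + η k)) this]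

/-- The perturbation of the exact relaxed step is summable. -/
theorem exists_error_bound (h : IsIteration C B β α K η U γ lam a b x) :
    ∃ e : ℕ → ℝ, Summable e ∧ (∀ k, 0 ≤ e k) ∧ ∀ k,
      wnorm (U k).inverse (x (k + 1) - (x k - lam k • stepResidual C B U γ x k)) ≤ e k := by
  have hα := h.alpha_pos
  have hβ := h.beta_pos
  -- The factor √(1/α) compares the weighted norm with the original one; 2β bounds γ‖U‖ in front of
  -- the error b k, which passes through a nonexpansive projection.
  refine ⟨fun k => √(1 / α) * (2 * β * (lam k * ‖b k‖) + lam k * ‖a k‖),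
    ((h.summable_b.mul_left _).add h.summable_a).mul_left _, fun k => ?_, fun k => ?_⟩
  · have := (h.lam_pos k).le
    positivity
  have hK : ‖U k‖ ≤ max K 1 := (h.norm_le k).trans (le_max_left _ _)
  have hm := isMetric_inverse hα (h.metric k) (by positivity) hK
  set W := (U k).inverse with hW
  have hup : ∀ v, wnorm W v ≤ √(1 / α) * ‖v‖ := fun v => by
    refine le_of_sq_le_sq ?_ (by positivity)
    rw [mul_pow, Real.sq_sqrt (by positivity)]
    exact hm.upper_wnorm v
  set p := wproj W C (x k - γ k • U k (B (x k) + b k)) with hp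
  set q := wproj W C (x k - γ k • U k (B (x k))) with hq
  have e1 : x (k + 1) - (x k - lam k • stepResidual C B U γ x k) = lam k • ((p - q) + a k) := by
    rw [h.step k, stepResidual, ← hW, ← hp, ← hq]
    module
  have h1 : wnorm W (p - q) ≤ √(1 / α) * (2 * β * ‖b k‖) := by
    refine (hm.wnorm_wproj_sub_le h.nonempty h.closed h.convex _ _).trans ((hup _).trans ?_)
    gcongr
    have e2 : x k - γ k • U k (B (x k) + b k) - (x k - γ k • U k (B (x k))) =
        -(γ k • U k (b k)) := by
      rw [map_add]; module
    rw [e2, norm_neg, norm_smul, Real.norm_of_nonneg (h.gamma_pos k).le]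
    calc γ k * ‖U k (b k)‖ ≤ γ k * (‖U k‖ * ‖b k‖) := by
          have := (h.gamma_pos k).le
          gcongr; exact (U k).le_opNorm _
      _ = γ k * ‖U k‖ * ‖b k‖ := by ring
      _ ≤ _ := mul_le_mul_of_nonneg_right (h.gamma_lt k).le (norm_nonneg _)
  rw [e1, wnorm_smul, abs_of_pos (h.lam_pos k)]
  have h2 := hm.wnorm_add_le (p - q) (a k)
  calc lam k * wnorm W (p - q + a k)
      ≤ lam k * (√(1 / α) * (2 * β * ‖b k‖) + √(1 / α) * ‖a k‖) := by
        refine mul_le_mul_of_nonneg_left ?_ (h.lam_pos k).le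
        linarith [hup (a k)]
    _ = _ := by ring

/-- Quasi-Fejér monotonicity in the variable metric, together with the summability of the decrease
that is produced by the exact steps. -/
theorem quasiFejer [Nontrivial H] (h : IsIteration C B β α K η U γ lam a b x) {z : H}
    (hz : z ∈ vipSolutions C B) :
    (∃ l : ℝ, Tendsto (fun k => wnorm (U k).inverse (x k - z)) atTop (𝓝 l)) ∧
      (Summable fun k => lam k * (1 / avgConst β (γ k) (U k) - lam k) *
        wnorm (U k).inverse (stepResidual C B U γ x k) ^ 2) ∧
      (∃ R, ∀ k, wnorm (U k).inverse (stepResidual C B U γ x k) ≤ R) ∧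
      Summable fun k => lam k * ((1 - γ k * ‖U k‖ / (2 * β)) * (γ k * ‖U k‖ / (2 * β) / 2) *
        wnorm (U k).inverse (stepResidual C B U γ x k) ^ 2) ^ 2 := by
  have hα := h.alpha_pos
  have hβ := h.beta_pos
  have hm := fun k => isMetric_inverse hα (h.metric k) (K := max K 1) (by positivity)
    ((h.norm_le k).trans (le_max_left _ _))
  have hWU := fun k => inverse_apply_apply hα (h.metric k)
  obtain ⟨e, hes, he0, he⟩ := h.exists_error_bound
  set r := stepResidual C B U γ x with hr
  set W := fun k => (U k).inverse with hW
  set δ : ℕ → ℝ := fun k => γ k * ‖U k‖ / (2 * β) with hδ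
  have hUpos : ∀ k, 0 < ‖U k‖ := fun k => hα.trans_le (alpha_le_norm (h.metric k))
  have hδ1 : ∀ k, δ k < 1 := fun k => by
    simp only [hδ]; rw [div_lt_one (by positivity)]; exact h.gamma_lt k
  choose S hS0 hS1 hS2 using fun k => exists_slack (hm k) (hWU k) hβ h.cocoercive h.closed
    h.convex (h.gamma_pos k) (hUpos k) (h.gamma_lt k) (x k) hz (δ := δ k) rfl (r := r k) rfl
  have hav : ∀ k, 1 / avgConst β (γ k) (U k) = 2 - δ k := fun k => one_div_avgConst hβ _ _
  set κ : ℕ → ℝ := fun k => lam k * (1 / avgConst β (γ k) (U k) - lam k) with hκ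
  have hκ0 : ∀ k, 0 ≤ κ k := fun k =>
    mul_nonneg (h.lam_pos k).le (sub_nonneg.2 (h.lam_lt k).le)
  set D : ℕ → ℝ := fun k => κ k * wnorm (W k) (r k) ^ 2 + 2 * (lam k * S k) with hD
  have hD1 : ∀ k, 0 ≤ κ k * wnorm (W k) (r k) ^ 2 := fun k => mul_nonneg (hκ0 k) (sq_nonneg _)
  have hD2 : ∀ k, 0 ≤ lam k * S k := fun k => mul_nonneg (h.lam_pos k).le (hS0 k)
  have hstep : ∀ k, wnorm (W k) (x k - z - lam k • r k) ^ 2 =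
      wnorm (W k) (x k - z) ^ 2 - D k := by
    intro k
    rw [(hm k).wnorm_sq, (hm k).inner_sub_self (x k - z), (hm k).inner_comm (x k - z) (lam k • r k),
      map_smul, real_inner_smul_left, real_inner_smul_left, real_inner_smul_right, hS1 k,
      ← (hm k).wnorm_sq, ← (hm k).wnorm_sq]
    simp only [hD, hκ, hav]
    ring
  obtain ⟨hlim, hDs⟩ := exists_tendsto_and_summable (fun k => wnorm_nonneg (W k) (x k - z))
    (fun k => wnorm_nonneg (W k) (x k - z - lam k • r k)) he0 hes h.eta_nonneg h.eta_summable
    (fun k => by simp only [hD]; linarith [hD1 k, hD2 k]) hstep fun k => by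
      refine (h.wnorm_succ_le k _).trans (mul_le_mul_of_nonneg_left ?_
        (by linarith [h.eta_nonneg k]))
      have e1 : x (k + 1) - z = (x k - z - lam k • r k) + (x (k + 1) - (x k - lam k • r k)) := by
        abel
      rw [e1]
      exact ((hm k).wnorm_add_le _ _).trans (by linarith [he k])
  obtain ⟨l, hl⟩ := hlim
  obtain ⟨V, hV0, hV⟩ := Tendsto.bddAbove_nat hl
  -- Since δ < 1, the slack identity and Cauchy-Schwarz give ½‖r‖² ≤ ‖r‖‖x - z‖.
  have hrV : ∀ k, wnorm (W k) (r k) ≤ 2 * V := by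
    intro k
    have h1 := (abs_le.1 ((hm k).abs_inner_le (r k) (x k - z))).2
    have h2 := wnorm_nonneg (W k) (r k)
    have h3 := mul_le_mul_of_nonneg_left (hV k) h2
    rw [hS1 k] at h1
    have h4 : 1 / 2 * wnorm (W k) (r k) ^ 2 ≤ wnorm (W k) (r k) * V := by
      nlinarith [hS0 k, hδ1 k, mul_nonneg (sub_nonneg.2 (hδ1 k).le) (sq_nonneg (wnorm (W k) (r k)))]
    rcases eq_or_ne (wnorm (W k) (r k)) 0 with h0 | h0
    · rw [h0]; positivity
    · have : 0 < wnorm (W k) (r k) := lt_of_le_of_ne h2 h0.symm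
      nlinarith
  refine ⟨⟨l, hl⟩, hDs.of_nonneg_of_le hD1 fun k => by simp only [hD]; linarith [hD2 k],
    ⟨2 * V, hrV⟩, ?_⟩
  -- With S ≤ 2V² and ‖x - z - r‖ ≤ 3V, the square of the slack bound is at most 2S² + 36V²S ≤
  -- 40V²S, and `D` contains 2λS.
  refine (hDs.mul_left (20 * V ^ 2)).of_nonneg_of_le
    (fun k => mul_nonneg (h.lam_pos k).le (sq_nonneg _)) fun k => ?_
  have hSV : S k ≤ 2 * V ^ 2 := by
    have h1 := (abs_le.1 ((hm k).abs_inner_le (r k) (x k - z))).2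
    have h2 := mul_le_mul (hrV k) (hV k) (wnorm_nonneg _ _) (by positivity)
    rw [hS1 k] at h1
    nlinarith [mul_nonneg (by linarith [hδ1 k] : 0 ≤ 1 - δ k / 2)
      (sq_nonneg (wnorm (W k) (r k)))]
  have h3V : wnorm (W k) (x k - z - r k) ≤ 3 * V := by
    have := (hm k).wnorm_add_le (x k - z) (-r k)
    have e1 : wnorm (W k) (-r k) = wnorm (W k) (r k) := by
      have := wnorm_smul (W k) (-1) (r k)
      simpa using this
    rw [e1, ← sub_eq_add_neg] at this
    linarith [hV k, hrV k]
  have hq := (hS2 k).trans (add_le_add_right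
    (mul_le_mul_of_nonneg_left h3V (Real.sqrt_nonneg (2 * S k))) (S k))
  have hδ0 : 0 ≤ δ k := by
    have := h.gamma_pos k
    simp only [hδ]; positivity
  have hq0 : 0 ≤ (1 - δ k) * (δ k / 2) * wnorm (W k) (r k) ^ 2 :=
    mul_nonneg (mul_nonneg (by linarith [hδ1 k]) (by linarith)) (sq_nonneg _)
  have hq2 := pow_le_pow_left₀ hq0 hq 2
  have hss := Real.sq_sqrt (by linarith [hS0 k] : 0 ≤ 2 * S k)
  have hq3 : ((1 - δ k) * (δ k / 2) * wnorm (W k) (r k) ^ 2) ^ 2 ≤ 40 * V ^ 2 * S k := by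
    have h1 : (S k + √(2 * S k) * (3 * V)) ^ 2 ≤
        2 * S k ^ 2 + 2 * (√(2 * S k) ^ 2 * (9 * V ^ 2)) := by
      nlinarith [sq_nonneg (S k - √(2 * S k) * (3 * V))]
    rw [hss] at h1
    have h2 := mul_le_mul_of_nonneg_right hSV (hS0 k)
    linarith
  have h4 := mul_le_mul_of_nonneg_left hq3 (h.lam_pos k).le
  have h5 : 20 * V ^ 2 * D k = 20 * V ^ 2 * (κ k * wnorm (W k) (r k) ^ 2) +
      lam k * (40 * V ^ 2 * S k) := by simp only [hD]; ring
  rw [h5]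
  exact h4.trans (le_add_of_nonneg_left (mul_nonneg (by positivity) (hD1 k)))

theorem bounded [Nontrivial H] (h : IsIteration C B β α K η U γ lam a b x) :
    ∃ M, ∀ k, ‖x k‖ ≤ M := by
  obtain ⟨z, hz⟩ := h.solvable
  obtain ⟨l, hl⟩ := (h.quasiFejer hz).1
  obtain ⟨V, hV0, hV⟩ := Tendsto.bddAbove_nat hl
  have hα := h.alpha_pos
  have hm := fun k => isMetric_inverse hα (h.metric k) (K := max K 1) (by positivity)
    ((h.norm_le k).trans (le_max_left _ _))
  set c := α / (max K 1) ^ 2 with hc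
  have hc0 : 0 < c := (hm 0).pos
  refine ⟨√(V ^ 2 / c) + ‖z‖, fun k => ?_⟩
  have h1 : ‖x k - z‖ ≤ √(V ^ 2 / c) := by
    refine Real.le_sqrt_of_sq_le ?_
    rw [le_div_iff₀ hc0, mul_comm]
    exact ((hm k).lower_wnorm _).trans (pow_le_pow_left₀ (wnorm_nonneg _ _) (hV k) 2)
  have h2 := norm_add_le (x k - z) z
  rw [sub_add_cancel] at h2
  linarith

theorem exists_weak_limit [Nontrivial H] (h : IsIteration C B β α K η U γ lam a b x)
    (hr : Tendsto (fun k => ‖stepResidual C B U γ x k‖) atTop (𝓝 0)) {γ₀ : ℝ} (hγ₀ : 0 < γ₀)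
    (hγ : ∀ k, γ₀ ≤ γ k) : ∃ z ∈ vipSolutions C B, WeaklyConverges x z := by
  have hα := h.alpha_pos
  have hm := fun k => isMetric_inverse hα (h.metric k) (K := max K 1) (by positivity)
    ((h.norm_le k).trans (le_max_left _ _))
  obtain ⟨M, hM⟩ := h.bounded
  refine exists_weaklyConverges hM hm
    (exists_tendsto_metric hm h.eta_nonneg h.eta_summable fun k v => ?_)
    (fun z hz => (h.quasiFejer hz).1) fun F hF z hz => ?_
  · exact inner_inverse_le hα (h.metric k) (h.metric (k + 1)) (by linarith [h.eta_nonneg k])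
      (h.mono k) v
  · exact mem_vipSolutions_of_weak_limit h.closed h.convex h.beta_pos h.cocoercive hM
      (fun k => ((hm k).wproj_spec h.nonempty h.closed h.convex _).1) hγ₀ hγ (by positivity)
      (fun k => (hm k).upper)
      (fun k y hy => forwardBackward_inner_nonneg (hm k) (inverse_apply_apply hα (h.metric k))
        h.nonempty h.closed h.convex (x k) hy) (hr.mono_left hF) hz

/-- The right-hand side of `mul_norm_sub_sq_le` is 2⟪W r, x - z⟫ - ‖r‖² in the weighted norm, which
is at most a constant times ‖r‖ because the iterates are bounded. -/
theorem tendsto_apply [Nontrivial H] (h : IsIteration C B β α K η U γ lam a b x)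
    (hr : Tendsto (fun k => ‖stepResidual C B U γ x k‖) atTop (𝓝 0)) {γ₀ ε : ℝ} (hγ₀ : 0 < γ₀)
    (hγ : ∀ k, γ₀ ≤ γ k) (hε : 0 < ε) (hγK : ∀ k, γ k * K ≤ 2 * β - ε) {z : H}
    (hz : z ∈ vipSolutions C B) : Tendsto (fun k => B (x k)) atTop (𝓝 (B z)) := by
  have hα := h.alpha_pos
  have hm := fun k => isMetric_inverse hα (h.metric k) (K := max K 1) (by positivity)
    ((h.norm_le k).trans (le_max_left _ _))
  obtain ⟨M, hM⟩ := h.bounded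
  rw [tendsto_iff_norm_sub_tendsto_zero]
  refine tendsto_zero_of_sq (squeeze_zero (fun k => sq_nonneg _)
    (g := fun k => 2 * (1 / α) * (M + ‖z‖) / (γ₀ * ε) * ‖stepResidual C B U γ x k‖)
    (fun k => ?_) (by simpa using hr.const_mul _))
  have h1 := mul_norm_sub_sq_le (hm k) (inverse_apply_apply hα (h.metric k)) h.cocoercive h.closed
    h.convex (h.gamma_pos k) (x k) hz (r := stepResidual C B U γ x k) rfl
  set r := stepResidual C B U γ x k
  rw [(hm k).wnorm_sq, (hm k).wnorm_sq, (hm k).inner_sub_self (x k - z) r,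
    (hm k).inner_comm (x k - z) r] at h1
  have h2 : inner ℝ ((U k).inverse r) (x k - z) ≤ 1 / α * ‖r‖ * (M + ‖z‖) :=
    (real_inner_le_norm _ _).trans (mul_le_mul ((hm k).upper r)
      ((norm_sub_le _ _).trans (by linarith [hM k])) (norm_nonneg _) (by positivity))
  have h3 : γ k * ‖U k‖ ≤ γ k * K := mul_le_mul_of_nonneg_left (h.norm_le k) (h.gamma_pos k).le
  have h4 : γ₀ * ε ≤ γ k * (2 * β - γ k * ‖U k‖) :=
    mul_le_mul (hγ k) (by linarith [hγK k]) hε.le (h.gamma_pos k).le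
  have h5 := mul_le_mul_of_nonneg_right h4 (sq_nonneg ‖B (x k) - B z‖)
  have h6 := (hm k).nonneg r
  rw [div_mul_eq_mul_div, le_div_iff₀ (by positivity)]
  linarith

theorem tendsto_stepResidual_of_le [Nontrivial H] (h : IsIteration C B β α K η U γ lam a b x)
    {lam₀ τ : ℝ} (hlam₀ : 0 < lam₀) (hτ : 0 < τ)
    (hlam : ∀ k, lam₀ ≤ lam k ∧ lam k ≤ 1 / avgConst β (γ k) (U k) - τ) :
    Tendsto (fun k => ‖stepResidual C B U γ x k‖) atTop (𝓝 0) := by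
  obtain ⟨z, hz⟩ := h.solvable
  have hs := (h.quasiFejer hz).2.1
  have hα := h.alpha_pos
  have hm := fun k => isMetric_inverse hα (h.metric k) (K := max K 1) (by positivity)
    ((h.norm_le k).trans (le_max_left _ _))
  set c := α / (max K 1) ^ 2 with hc
  have hc0 : 0 < c := (hm 0).pos
  have hg := hs.tendsto_atTop_zero.const_mul (1 / (lam₀ * τ * c))
  rw [mul_zero] at hg
  refine tendsto_zero_of_sq (squeeze_zero (fun k => sq_nonneg _) (fun k => ?_) hg)
  set r := stepResidual C B U γ x k
  rw [one_div, inv_mul_eq_div, le_div_iff₀ (by positivity)]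
  have h1 : lam₀ * τ ≤ lam k * (1 / avgConst β (γ k) (U k) - lam k) :=
    mul_le_mul (hlam k).1 (by linarith [(hlam k).2]) hτ.le (h.lam_pos k).le
  have h2 := mul_le_mul h1 ((hm k).lower_wnorm r) (by positivity)
    ((by positivity : 0 ≤ lam₀ * τ).trans h1)
  linarith

/-- The relaxation may approach its upper limit, so the information comes from the summable fourth
powers in `quasiFejer`. Passing to the fixed residual allows consecutive iterates to be compared
without comparing metrics or step sizes. -/
theorem tendsto_stepResidual_of_not_summable [Nontrivial H]
    (h : IsIteration C B β α K η U γ lam a b x) {γ₀ ε : ℝ} (hγ₀ : 0 < γ₀)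
    (hγ : ∀ k, γ₀ ≤ γ k) (hε : 0 < ε) (hγK : ∀ k, γ k * K ≤ 2 * β - ε) (hlam : ¬ Summable lam) :
    Tendsto (fun k => ‖stepResidual C B U γ x k‖) atTop (𝓝 0) := by
  obtain ⟨z, hz⟩ := h.solvable
  obtain ⟨-, -, ⟨R, hR⟩, hs⟩ := h.quasiFejer hz
  obtain ⟨e, hes, he0, he⟩ := h.exists_error_bound
  have hα := h.alpha_pos
  have hβ := h.beta_pos
  have hm := fun k => isMetric_inverse hα (h.metric k) (K := max K 1) (by positivity)
    ((h.norm_le k).trans (le_max_left _ _))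
  set c := α / (max K 1) ^ 2 with hc
  have hc0 : 0 < c := (hm 0).pos
  have hαU : ∀ k, α ≤ ‖U k‖ := fun k => alpha_le_norm (h.metric k)
  have hγG : ∀ k, γ k ≤ 2 * β / α := fun k => by
    rw [le_div_iff₀ hα]
    exact (mul_le_mul_of_nonneg_left (hαU k) (h.gamma_pos k).le).trans (h.gamma_lt k).le
  have hlow : ∀ k v t, wnorm (U k).inverse v ≤ t → ‖v‖ ≤ t / √c := fun k v t hv => by
    rw [le_div_iff₀ (Real.sqrt_pos.2 hc0)]
    refine le_of_sq_le_sq ?_ ((wnorm_nonneg _ _).trans hv)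
    rw [mul_pow, Real.sq_sqrt hc0.le, mul_comm]
    exact ((hm k).lower_wnorm v).trans (pow_le_pow_left₀ (wnorm_nonneg _ _) hv 2)
  obtain ⟨Q, hQ0, hQ⟩ := residual_equiv h.nonempty h.closed h.convex (c := c) (d := 1 / α)
    hγ₀ (by positivity : 0 < 2 * β / α) hc0
  have hQ1 : ∀ k, ‖stepResidual C B U γ x k‖ ≤ Q * ‖residual C B (x k)‖ := fun k =>
    (hQ B _ _ (γ k) (hm k) (inverse_apply_apply hα (h.metric k)) (hγ k) (hγG k) (x k)).1
  have hQ2 : ∀ k, ‖residual C B (x k)‖ ≤ Q * ‖stepResidual C B U γ x k‖ := fun k =>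
    (hQ B _ _ (γ k) (hm k) (inverse_apply_apply hα (h.metric k)) (hγ k) (hγG k) (x k)).2
  set r := stepResidual C B U γ x with hr
  have hlam2 : ∀ k, lam k ≤ 2 := fun k => by
    have h1 := h.lam_lt k
    rw [one_div_avgConst hβ] at h1
    have : 0 ≤ γ k * ‖U k‖ / (2 * β) := by
      have := h.gamma_pos k
      positivity
    linarith
  have hρ : Tendsto (fun k => ‖residual C B (x k)‖) atTop (𝓝 0) := by
    -- The three factors are lower bounds for 1 - δ, for δ/2 and for the ratio of the squared
    -- weighted norm to the original one.
    set m := ε / (2 * β) * (γ₀ * α / (2 * β) / 2) * c with hm'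
    have hm0 : 0 < m := by positivity
    refine tendsto_zero_of_summable_mul_pow (Λ := 2) (R := Q * (R / √c))
      (L := (2 + 1 / β) * Q) (e := fun k => (2 + 1 / β) * (e k / √c)) (t := lam)
      (fun k => norm_nonneg _) (fun k => ?_) (by positivity) (fun k => (h.lam_pos k).le) hlam2 hlam
      (fun k => by have := he0 k; positivity) ((hes.div_const _).mul_left _) (fun k => ?_) ?_
    · exact (hQ2 k).trans (mul_le_mul_of_nonneg_left (hlow k _ _ (hR k)) hQ0)
    · have h1 := norm_residual_sub_le h.nonempty h.closed h.convex hβ h.cocoercive (x (k + 1)) (x k)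
      have h2 := norm_le_norm_add_norm_sub' (residual C B (x (k + 1))) (residual C B (x k))
      have h3 : ‖x (k + 1) - x k‖ ≤ lam k * (Q * ‖residual C B (x k)‖) + e k / √c := by
        have e1 : x (k + 1) - x k = (x (k + 1) - (x k - lam k • r k)) - lam k • r k := by abel
        rw [e1]
        refine (norm_sub_le _ _).trans ?_
        rw [norm_smul, Real.norm_of_nonneg (h.lam_pos k).le]
        have h4 := mul_le_mul_of_nonneg_left (hQ1 k) (h.lam_pos k).le
        linarith [hlow k _ _ (he k)]
      have h5 := mul_le_mul_of_nonneg_left h3 (by positivity : 0 ≤ 2 + 1 / β)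
      linarith
    · refine (hs.mul_left (Q ^ 4 / m ^ 2)).of_nonneg_of_le
        (fun k => mul_nonneg (h.lam_pos k).le (by positivity)) fun k => ?_
      have hγk := h.gamma_pos k
      have h1 : ε / (2 * β) ≤ 1 - γ k * ‖U k‖ / (2 * β) := by
        rw [le_sub_iff_add_le, ← add_div, div_le_one (by positivity)]
        linarith [mul_le_mul_of_nonneg_left (h.norm_le k) hγk.le, hγK k]
      have h2 : γ₀ * α / (2 * β) / 2 ≤ γ k * ‖U k‖ / (2 * β) / 2 := by
        gcongr
        · exact hγ k
        · exact hαU k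
      have h3 : m * ‖r k‖ ^ 2 ≤ (1 - γ k * ‖U k‖ / (2 * β)) * (γ k * ‖U k‖ / (2 * β) / 2) *
          wnorm (U k).inverse (r k) ^ 2 := by
        rw [hm', mul_assoc]
        have h4 := (by positivity : 0 ≤ ε / (2 * β)).trans h1
        exact mul_le_mul (mul_le_mul h1 h2 (by positivity) h4) ((hm k).lower_wnorm _)
          (by positivity) (by positivity)
      have h5 := pow_le_pow_left₀ (by positivity) h3 2
      have h6 := pow_le_pow_left₀ (norm_nonneg _) (hQ2 k) 4
      have h7 : Q ^ 4 / m ^ 2 * (m * ‖r k‖ ^ 2) ^ 2 = (Q * ‖r k‖) ^ 4 := by field_simp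
      have h8 := mul_le_mul_of_nonneg_left h5 (by positivity : 0 ≤ Q ^ 4 / m ^ 2)
      rw [h7] at h8
      have h9 := mul_le_mul_of_nonneg_left (h6.trans h8) (h.lam_pos k).le
      linarith
  exact squeeze_zero (fun k => norm_nonneg _) hQ1 (by simpa using hρ.const_mul Q)

end IsIteration

end VMFB

theorem theorem4p1 {H : Type*} [NormedAddCommGroup H] [InnerProductSpace ℝ H] [CompleteSpace H]
    (C : Set H) (hC_closed : IsClosed C) (hC_convex : Convex ℝ C)
    (B : H → H) (β : ℝ) (hβ : 0 < β) (hB : VMFB.IsCocoercive β B)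
    (hΩ : (VMFB.vipSolutions C B).Nonempty)
    -- the metric operators
    (α : ℝ) (hα : 0 < α) (η : ℕ → ℝ) (hη_nonneg : ∀ k, 0 ≤ η k) (hη_sum : Summable η)
    (U : ℕ → H →L[ℝ] H) (hU : ∀ k, U k ∈ VMFB.strongPos α)
    (μ : ℝ) (hμ : IsLUB (Set.range fun k => ‖U k‖) μ)
    (hU_mono : ∀ k, U k ≤ (1 + η k) • U (k + 1))
    -- step sizes `γ k ∈ (0, 2β/‖U k‖)` and relaxation parameters `lam k ∈ (0, 1/α_k)`
    (γ : ℕ → ℝ) (hγ_pos : ∀ k, 0 < γ k) (hγ_lt : ∀ k, γ k * ‖U k‖ < 2 * β)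
    (lam : ℕ → ℝ) (hlam_pos : ∀ k, 0 < lam k)
    (hlam_lt : ∀ k, lam k < 1 / VMFB.avgConst β (γ k) (U k))
    -- errors
    (a b : ℕ → H) (ha : Summable fun k => lam k * ‖a k‖) (hb : Summable fun k => lam k * ‖b k‖)
    -- the iteration, with arbitrary starting point `x 0`
    (x y : ℕ → H)
    (hy : ∀ k, y k = x k - γ k • U k (B (x k) + b k))
    (hx : ∀ k, x (k + 1) = x k + lam k • (VMFB.wproj (U k).inverse C (y k) + a k - x k)) :
    -- (i)
    (∀ z ∈ VMFB.vipSolutions C B,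
      ∃ l : ℝ, Tendsto (fun k => VMFB.wnorm (U k).inverse (x k - z)) atTop (𝓝 l)) ∧
    -- (ii), (iii), (iv) under the first set of conditions
    (∀ lamLow τ : ℝ, 0 < lamLow → 0 < τ →
      (∀ k, lamLow ≤ lam k ∧ lam k ≤ 1 / VMFB.avgConst β (γ k) (U k) - τ) →
      Tendsto (fun k => ‖x k - VMFB.wproj (U k).inverse C (x k - γ k • U k (B (x k)))‖)
        atTop (𝓝 0) ∧
      ∀ γLow : ℝ, 0 < γLow → (∀ k, γLow ≤ γ k) →
        (∃ z ∈ VMFB.vipSolutions C B, VMFB.WeaklyConverges x z) ∧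
        ∀ ε : ℝ, 0 < ε → (∀ k, γ k * μ ≤ 2 * β - ε) →
          ∀ z ∈ VMFB.vipSolutions C B, Tendsto (fun k => B (x k)) atTop (𝓝 (B z))) ∧
    -- (ii), (iii), (iv) under the second set of conditions
    (∀ γLow ε : ℝ, 0 < γLow → 0 < ε →
      Tendsto (fun n => ∑ k ∈ Finset.range n,
        lam k * (1 / VMFB.avgConst β (γ k) (U k) - lam k)) atTop atTop →
      (∀ k, γLow ≤ γ k ∧ γ k * μ ≤ 2 * β - ε) →
      (Summable fun k => |γ (k + 1) - γ k|) →
      (Summable fun k => |γ (k + 1) * ‖U (k + 1)‖ - γ k * ‖U k‖|) →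
      (∀ v : H, Summable fun k => ‖(U k).inverse v - (U (k + 1)).inverse v‖) →
      Tendsto (fun k => ‖x k - VMFB.wproj (U k).inverse C (x k - γ k • U k (B (x k)))‖)
        atTop (𝓝 0) ∧
      (∃ z ∈ VMFB.vipSolutions C B, VMFB.WeaklyConverges x z) ∧
      ∀ lamLow : ℝ, 0 < lamLow → (∀ k, lamLow ≤ lam k) →
        ∀ z ∈ VMFB.vipSolutions C B, Tendsto (fun k => B (x k)) atTop (𝓝 (B z))) := by
  have hαk : ∀ k, 1 / VMFB.avgConst β (γ k) (U k) = 2 - γ k * ‖U k‖ / (2 * β) := fun k =>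
    VMFB.one_div_avgConst hβ _ _
  -- In the zero space ‖U‖ = 0, so δ > 0 fails and the one-step estimate is unavailable; there
  -- everything is constant.
  rcases subsingleton_or_nontrivial H with hH | hH
  · obtain ⟨z, hz⟩ := hΩ
    have hw : VMFB.WeaklyConverges x z :=
      tendsto_const_nhds.congr fun k => congrArg _ (Subsingleton.elim _ _)
    have hr : Tendsto (fun k => ‖x k - VMFB.wproj (U k).inverse C (x k - γ k • U k (B (x k)))‖)
        atTop (𝓝 0) :=
      tendsto_const_nhds.congr fun k => by rw [Subsingleton.elim (x k - _) 0, norm_zero]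
    have hB' : ∀ z, Tendsto (fun k => B (x k)) atTop (𝓝 (B z)) := fun z =>
      tendsto_const_nhds.congr fun k => Subsingleton.elim _ _
    refine ⟨fun z _ => ⟨0, tendsto_const_nhds.congr fun k => ?_⟩,
      fun _ _ _ _ _ => ⟨hr, fun _ _ _ => ⟨⟨z, hz, hw⟩, fun _ _ _ z _ => hB' z⟩⟩,
      fun _ _ _ _ _ _ _ _ _ => ⟨hr, ⟨z, hz, hw⟩, fun _ _ _ z _ => hB' z⟩⟩
    rw [Subsingleton.elim (x k - z) 0, VMFB.wnorm, inner_zero_right, Real.sqrt_zero]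
  · have h : VMFB.IsIteration C B β α μ η U γ lam a b x :=
      ⟨hC_closed, hC_convex, hβ, hB, hΩ, hα, hη_nonneg, hη_sum, hU, fun k => hμ.1 ⟨k, rfl⟩, hU_mono,
        hγ_pos, hγ_lt, hlam_pos, hlam_lt, ha, hb, fun k => by rw [hx k, hy k]⟩
    refine ⟨fun z hz => (h.quasiFejer hz).1, fun lamLow τ hlamLow hτ hlam => ?_,
      fun γLow ε hγLow hε hdiv hγ _ _ _ => ?_⟩
    · have hr := h.tendsto_stepResidual_of_le hlamLow hτ hlam
      exact ⟨hr, fun γLow hγLow hγ => ⟨h.exists_weak_limit hr hγLow hγ,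
        fun ε hε hγμ z hz => h.tendsto_apply hr hγLow hγ hε hγμ hz⟩⟩
    -- The factor 1/α_k - λ_k is at most 2, so divergence of the weighted sum forces ∑ λ_k = ∞.
    · have hns : ¬ Summable lam := fun hs => by
        have hs' : Summable fun k => lam k * (1 / VMFB.avgConst β (γ k) (U k) - lam k) := by
          refine (hs.mul_left 2).of_nonneg_of_le
            (fun k => mul_nonneg (hlam_pos k).le (sub_nonneg.2 (hlam_lt k).le)) fun k => ?_
          have h1 : 0 ≤ γ k * ‖U k‖ / (2 * β) := by
            have := hγ_pos k
            positivity
          rw [mul_comm 2]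
          exact mul_le_mul_of_nonneg_left (by linarith [hαk k, hlam_pos k]) (hlam_pos k).le
        exact not_tendsto_atTop_of_tendsto_nhds hs'.hasSum.tendsto_sum_nat hdiv
      have hr := h.tendsto_stepResidual_of_not_summable hγLow (fun k => (hγ k).1) hε
        (fun k => (hγ k).2) hns
      exact ⟨hr, h.exists_weak_limit hr hγLow fun k => (hγ k).1,
        fun _ _ _ z hz => h.tendsto_apply hr hγLow (fun k => (hγ k).1) hε (fun k => (hγ k).2) hz⟩
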